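/- Let $\mathbb K=\mathbb R$ or $\mathbb C$, $n\ge 1$, and let $\mathcal X^1,\dots,\mathcal X^n,\mathcal Y$ be $\mathcal C^\infty$ functions of $(x,y)=(x^1,\dots,x^n,y)\in\mathbb K^n\times\mathbb K$ (for $\mathbb K=\mathbb C$, differentiability is in the complex sense). Let $y_{k_1,\dots,k_l}$ ($l\ge1$, $1\le k_1,\dots,k_l\le n$) be the jet coordinates, which are symmetric in their indices and otherwise independent, and let $$D_i^{a}=\frac{\partial}{\partial x^i}+y_i\frac{\partial}{\partial y}+\sum y_{i,k_1}\frac{\partial}{\partial y_{k_1}}+\cdots+\sum y_{i,k_1,\dots,k_{a-1}}\frac{\partial}{\partial y_{k_1,\dots,k_{a-1}}}$$ be the total differentiation operators, each sum having one term for every coordinate $y_{k_1,\dots,k_l}$, i.e. for every multiset $\{k_1,\dots,k_l\}$. The coefficients $\mathbf Y_{i_1,\dots,i_\kappa}$ of the prolongation of the vector field $\sum_k\mathcal X^k\,\partial/\partial x^k+\mathcal Y\,\partial/\partial y$ are defined by $\mathbf Y_{i_1}=D^1_{i_1}(\mathcal Y)-\sum_{k=1}^n D^1_{i_1}(\mathcal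 X^k)\,y_k$ and, for $\kappa\ge 2$, $$\mathbf Y_{i_1,\dots,i_\kappa}=D^\kappa_{i_\kappa}(\mathbf Y_{i_1,\dots,i_{\kappa-1}})-\sum_{k=1}^nD^1_{i_\kappa}(\mathcal X^k)\,y_{i_1,\dots,i_{\kappa-1},k}.$$ Notation. For integers $1\le\lambda_1<\cdots<\lambda_d$ and $\mu_1,\dots,\mu_d\ge1$ put $N=\mu_1\lambda_1+\cdots+\mu_d\lambda_d$ and $M=\mu_1+\cdots+\mu_d$. Identify $\{1,\dots,N\}$ with the set of triples $e{:}\nu{:}j$ ($1\le e\le d$, $1\le\nu\le\mu_e$, $1\le j\le\lambda_e$) in lexicographic order. Let $\mathfrak S_N$ be the group of permutations of this set, and $\mathfrak H\subset\mathfrak S_N$ the subgroup of the $\sigma$ that leave the formal monomial $\prod_{e}\prod_{\nu}y_{k_{e:\nu:1},\dots,k_{e:\nu:\lambda_e}}$ (the indices $k_{e:\nu:j}$ being distinct symbols) unchanged when every $k_{e:\nu:j}$ is replaced by $k_{\sigma(e:\nu:j)}$. Let $\mathfrak F=\mathfrak F_N^{(\mu_1,\lambda_1),\dots,(\mu_d,\lambda_d)}$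 be any set of representatives of the cosets $\mathfrak H\sigma$, $\sigma\in\mathfrak S_N$, where $(h\sigma)(\alpha)=h(\sigma(\alpha))$. For $0\le q\le\kappa$ let $\mathfrak S_\kappa^q$ be the set of permutations $\tau$ of $\{1,\dots,\kappa\}$ with $\tau(1)<\cdots<\tau(q)$ and $\tau(q+1)<\cdots<\tau(\kappa)$, and let $\mathfrak S_\kappa^{\kappa+1}=\emptyset$. Let $\delta_{i_1,\dots,i_r}^{k_1,\dots,k_r}=\delta_{i_1}^{k_1}\cdots\delta_{i_r}^{k_r}$. Theorem. First, $|\mathfrak H|=\prod_{e=1}^d\mu_e!\,(\lambda_e!)^{\mu_e}$ for all such $\lambda_e,\mu_e$. Secondly, for every $\kappa\ge1$ and all $i_1,\dots,i_\kappa\in\{1,\dots,n\}$, and for every choice of the sets of representatives $\mathfrak F$, $$\begin{aligned}\mathbf Y_{i_1,\dots,i_\kappa}={}&\frac{\partial^\kappa\mathcal Y}{\partial x^{i_1}\cdots\partial x^{i_\kappa}}+\sum_{d=1}^{\kappa+1}\ \sum_{1\le\lambda_1<\cdots<\lambda_d\le\kappa}\ \sum_{\substack{\mu_1,\dots,\mu_d\ge1\\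 \mu_1\lambda_1+\cdots+\mu_d\lambda_d\le\kappa+1}}\ \sum_{(k_{e:\nu:j})\in\{1,\dots,n\}^N}\\ &\Bigg[\sum_{\sigma\in\mathfrak F}\sum_{\tau\in\mathfrak S_\kappa^{N}}\delta_{i_{\tau(1)},\dots,i_{\tau(N)}}^{k_{\sigma(1:1:1)},\dots,k_{\sigma(d:\mu_d:\lambda_d)}}\ \frac{\partial^{\kappa-N+M}\mathcal Y}{\partial x^{i_{\tau(N+1)}}\cdots\partial x^{i_{\tau(\kappa)}}(\partial y)^{M}}\\ &\ -\sum_{\sigma\in\mathfrak F}\sum_{\tau\in\mathfrak S_\kappa^{N-1}}\delta_{i_{\tau(1)},\dots,i_{\tau(N-1)}}^{k_{\sigma(1:1:1)},\dots,k_{\sigma(d:\mu_d:\lambda_d-1)}}\ \frac{\partial^{\kappa-N+M}\mathcal X^{k_{\sigma(d:\mu_d:\lambda_d)}}}{\partial x^{i_{\tau(N)}}\cdots\partial x^{i_{\tau(\kappa)}}(\partial y)^{M-1}}\Bigg]\ \prod_{e=1}^d\prod_{\nu=1}^{\mu_e}y_{k_{e:\nu:1},\dots,k_{e:\nu:\lambda_e}},\end{aligned}$$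 where in the second line the upper indices of $\delta$ are the first $N-1$ of the $N$ indices $k_{\sigma(e:\nu:j)}$ in lexicographic order. -/

import Mathlib

open scoped ContDiff Nat

namespace LieProlongation

/-! ### Base space, jet space and partial derivatives -/

/-- The space of the variables `(x, y)`, with `x = (x¹, …, xⁿ)` and one dependent variable `y`. -/
abbrev Base (𝕜 : Type*) (n : ℕ) : Type _ := (Fin n → 𝕜) × 𝕜

/-- The jet space of scalar functions of `n` variables: a point is `(x, (y_M)_M)`, where `M` runs
over the finite multisets of indices. Indexing by multisets encodes the symmetry
`y_{i_1, …, i_l} = y_{i_{σ(1)}, …, i_{σ(l)}}`; the coordinate `y` itself is `y_∅`. Jets of all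
orders are kept in one space; an expression of order at most `κ` only reads the coordinates `y_M`
with `M.card ≤ κ`. -/
abbrev Jet (𝕜 : Type*) (n : ℕ) : Type _ := (Fin n → 𝕜) × (Multiset (Fin n) → 𝕜)

/-- The index multiset `{k_1, …, k_l}` of the jet variable `y_{k_1, …, k_l}`. -/
def tuple {α : Type*} {l : ℕ} (k : Fin l → α) : Multiset α :=
  Finset.univ.val.map k

section Calculus

variable {𝕜 : Type*} [RCLike 𝕜] {n : ℕ}

/-- `∂f / ∂xⁱ` for a function `f` of `(x, y)`. -/
noncomputable def dx (i : Fin n) (f : Base 𝕜 n → 𝕜) : Base 𝕜 n → 𝕜 :=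
  fun p => lineDeriv 𝕜 f p (Pi.single i 1, 0)

/-- `∂f / ∂y` for a function `f` of `(x, y)`. -/
noncomputable def dy (f : Base 𝕜 n → 𝕜) : Base 𝕜 n → 𝕜 :=
  fun p => lineDeriv 𝕜 f p (0, 1)

/-- The iterated partial derivative `∂^{r + b} f / (∂x^{j_1} ⋯ ∂x^{j_r} (∂y)^b)`. -/
noncomputable def partialXY {r : ℕ} (j : Fin r → Fin n) (b : ℕ) (f : Base 𝕜 n → 𝕜) :
    Base 𝕜 n → 𝕜 :=
  (List.ofFn j).foldr dx (dy^[b] f)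

/-- The point `(x, y)` below a jet. -/
def Jet.base (p : Jet 𝕜 n) : Base 𝕜 n := (p.1, p.2 0)

/-- A function of `(x, y)`, seen as a function on the jet space. -/
def lift (f : Base 𝕜 n → 𝕜) : Jet 𝕜 n → 𝕜 := fun p => f (Jet.base p)

/-- `∂F / ∂xⁱ` on the jet space. -/
noncomputable def jetDx (i : Fin n) (F : Jet 𝕜 n → 𝕜) : Jet 𝕜 n → 𝕜 :=
  fun p => lineDeriv 𝕜 F p (Pi.single i 1, 0)

/-- `∂F / ∂y_M` on the jet space. -/
noncomputable def jetDy (M : Multiset (Fin n)) (F : Jet 𝕜 n → 𝕜) : Jet 𝕜 n → 𝕜 :=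
  fun p => lineDeriv 𝕜 F p (0, Pi.single M 1)

/-- The `i`-th total differentiation operator of order `a`,
`D_i^a = ∂/∂xⁱ + y_i ∂/∂y + ∑ y_{i, k_1} ∂/∂y_{k_1} + ⋯ + ∑ y_{i, k_1, …, k_{a-1}} ∂/∂y_{k_1, …, k_{a-1}}`,
where each sum has one term for every coordinate `y_{k_1, …, k_l}` of the jet space, i.e. for
every multiset `{k_1, …, k_l}`. -/
noncomputable def totalD (a : ℕ) (i : Fin n) (F : Jet 𝕜 n → 𝕜) : Jet 𝕜 n → 𝕜 :=
  fun p => jetDx i F p +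
    ∑ l ∈ Finset.range a, ∑ M : Sym (Fin n) l,
      p.2 (i ::ₘ (M : Multiset (Fin n))) * jetDy (M : Multiset (Fin n)) F p

/-- The coefficients `𝐘_{i_1, …, i_κ}` of the prolongation to the jet spaces of the vector field
`∑ₖ 𝒳ᵏ ∂/∂xᵏ + 𝒴 ∂/∂y`, with `𝐘 = 𝒴` for `κ = 0` and
`𝐘_{i_1, …, i_{κ+1}} = D_{i_{κ+1}}^{κ+1} (𝐘_{i_1, …, i_κ}) - ∑ₖ D_{i_{κ+1}}^1 (𝒳ᵏ) y_{i_1, …, i_κ, k}`. -/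
noncomputable def prolong (𝒳 : Fin n → Base 𝕜 n → 𝕜) (𝒴 : Base 𝕜 n → 𝕜) :
    (κ : ℕ) → (Fin κ → Fin n) → Jet 𝕜 n → 𝕜
  | 0, _ => lift 𝒴
  | κ + 1, i => fun p =>
      totalD (κ + 1) (i (Fin.last κ)) (prolong 𝒳 𝒴 κ (Fin.init i)) p -
        ∑ k : Fin n, totalD 1 (i (Fin.last κ)) (lift (𝒳 k)) p * p.2 (k ::ₘ tuple (Fin.init i))

end Calculus

/-! ### Combinatorics -/

/-- The set of the triples `e:ν:j` with `e < d`, `ν < μ_e`, `j < λ_e`. -/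
abbrev Pos (d : ℕ) (lam mu : Fin d → ℕ) : Type :=
  (e : Fin d) × (Fin (mu e) × Fin (lam e))

/-- `μ_1 λ_1 + ⋯ + μ_d λ_d`. -/
def weight {d : ℕ} (lam mu : Fin d → ℕ) : ℕ := ∑ e, mu e * lam e

/-- The lexicographic numbering of the triples `e:ν:j` by the integers below
`μ_1 λ_1 + ⋯ + μ_d λ_d`. -/
def posEquiv {d : ℕ} (lam mu : Fin d → ℕ) : Pos d lam mu ≃ Fin (weight lam mu) :=
  (Equiv.sigmaCongrRight fun _ => finProdFinEquiv).trans finSigmaFinEquiv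

/-- The monomial `∏_e ∏_ν y_{k_{e:ν:1}, …, k_{e:ν:λ_e}}`. -/
def jetMonomial {α R : Type*} [CommSemiring R] {d : ℕ} {lam mu : Fin d → ℕ}
    (y : Multiset α → R) (k : Pos d lam mu → α) : R :=
  ∏ e : Fin d, ∏ ν : Fin (mu e), y (tuple fun j : Fin (lam e) => k ⟨e, ν, j⟩)

theorem rename_jetMonomial {α β : Type*} {d : ℕ} {lam mu : Fin d → ℕ}
    (s : α → β) (k : Pos d lam mu → α) :
    MvPolynomial.rename (Multiset.map s)
        (jetMonomial (MvPolynomial.X (R := ℤ)) k) =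
      jetMonomial (MvPolynomial.X (R := ℤ)) (s ∘ k) := by
  simp [jetMonomial, tuple, Function.comp_def]

/-- The group `ℌ` of the permutations `σ` of the triples `e:ν:j` that leave the general monomial
unchanged: `∏ y_{k_{σ(e:ν:1)}, …, k_{σ(e:ν:λ_e)}} = ∏ y_{k_{e:ν:1}, …, k_{e:ν:λ_e}}`. This is an
identity between formal monomials: the indices `k_{e:ν:j}` are distinct symbols. -/
noncomputable def stab {d : ℕ} (lam mu : Fin d → ℕ) : Subgroup (Equiv.Perm (Pos d lam mu)) where
  carrier := {σ | jetMonomial (MvPolynomial.X (R := ℤ)) (fun a => σ a) =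
    jetMonomial (MvPolynomial.X (R := ℤ)) (fun a => a)}
  one_mem' := rfl
  mul_mem' := by
    intro a b ha hb
    have ha' : jetMonomial (MvPolynomial.X (R := ℤ)) (fun c => a c) =
      jetMonomial (MvPolynomial.X (R := ℤ)) (fun c : Pos d lam mu => c) := ha
    have hb' : jetMonomial (MvPolynomial.X (R := ℤ)) (fun c => b c) =
      jetMonomial (MvPolynomial.X (R := ℤ)) (fun c : Pos d lam mu => c) := hb
    have h := congrArg (MvPolynomial.rename (Multiset.map a)) hb'
    rw [rename_jetMonomial, rename_jetMonomial] at h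
    exact h.trans ha'
  inv_mem' := by
    intro a ha
    have ha' : jetMonomial (MvPolynomial.X (R := ℤ)) (fun c => a c) =
      jetMonomial (MvPolynomial.X (R := ℤ)) (fun c : Pos d lam mu => c) := ha
    have h := congrArg (MvPolynomial.rename (Multiset.map (a⁻¹ : Equiv.Perm _))) ha'
    rw [rename_jetMonomial, rename_jetMonomial] at h
    have e : ((a⁻¹ : Equiv.Perm (Pos d lam mu)) ∘ fun c => a c) = fun c => c := by
      funext c
      simp
    rw [e] at h
    exact h.symm

/-- The set `𝔖_p^q` of the permutations `τ` of `{1, …, p}` with `τ(1) < ⋯ < τ(q)` and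
`τ(q+1) < ⋯ < τ(p)`. For `q = 0` and `q = p` it consists of the identity, for `q > p` it is
empty. -/
def shuffles (p q : ℕ) : Finset (Equiv.Perm (Fin p)) :=
  {τ | q ≤ p ∧ (∀ a b : Fin p, a < b → (b : ℕ) < q → τ a < τ b) ∧
    (∀ a b : Fin p, q ≤ (a : ℕ) → a < b → τ a < τ b)}

/-- The multiple Kronecker symbol `δ_{i_1, …, i_r}^{k_1, …, k_r}`, the product of the
`δ_{i_a}^{k_a}`. -/
def kron {n r : ℕ} (i k : Fin r → Fin n) (R : Type*) [CommSemiring R] : R :=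
  ∏ a, if i a = k a then 1 else 0

/-- The first `q` entries of a `p`-tuple. -/
def firstPart {α : Type*} {p : ℕ} (q : ℕ) (hq : q ≤ p) (i : Fin p → α) : Fin q → α :=
  fun a => i (Fin.castLE hq a)

/-- The last `p - q` entries of a `p`-tuple. -/
def lastPart {α : Type*} {p : ℕ} (q : ℕ) (i : Fin p → α) : Fin (p - q) → α :=
  fun a => i ⟨q + a, by omega⟩

/-! ### The two terms in the bracket and the right-hand side of the formula -/

section Formula

variable {𝕜 : Type*} [RCLike 𝕜] {n κ : ℕ} {d : ℕ} {lam mu : Fin d → ℕ}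

/-- The tuple of the `k_{σ(e:ν:j)}`, with the triples `e:ν:j` in lexicographic order. -/
def permuted (k : Pos d lam mu → Fin n) (σ : Equiv.Perm (Pos d lam mu)) :
    Fin (weight lam mu) → Fin n :=
  fun a => k (σ ((posEquiv lam mu).symm a))

open scoped Classical in
/-- With `N = μ_1 λ_1 + ⋯ + μ_d λ_d`, the sum over `τ ∈ 𝔖_κ^N` of
`δ_{i_{τ(1)}, …, i_{τ(N)}}^{k_{σ(1:1:1)}, …, k_{σ(d:μ_d:λ_d)}}` times
`∂^{κ - N + μ_1 + ⋯ + μ_d} 𝒴 / (∂x^{i_{τ(N+1)}} ⋯ ∂x^{i_{τ(κ)}} (∂y)^{μ_1 + ⋯ + μ_d})`.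
It is an empty sum if `N > κ`. -/
noncomputable def termY (𝒴 : Base 𝕜 n → 𝕜) (i : Fin κ → Fin n) (k : Pos d lam mu → Fin n)
    (σ : Equiv.Perm (Pos d lam mu)) (p : Base 𝕜 n) : 𝕜 :=
  if h : weight lam mu ≤ κ then
    ∑ τ ∈ shuffles κ (weight lam mu),
      kron (firstPart (weight lam mu) h (i ∘ τ)) (permuted k σ) 𝕜 *
        partialXY (lastPart (weight lam mu) (i ∘ τ)) (∑ e, mu e) 𝒴 p
  else 0

open scoped Classical in
/-- With `N = μ_1 λ_1 + ⋯ + μ_d λ_d`, the sum over `τ ∈ 𝔖_κ^{N-1}` of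
`δ_{i_{τ(1)}, …, i_{τ(N-1)}}^{k_{σ(1:1:1)}, …, k_{σ(d:μ_d:λ_d-1)}}` (all the `k_{σ(e:ν:j)}` but the
last one) times
`∂^{κ - N + μ_1 + ⋯ + μ_d} 𝒳^{k_{σ(d:μ_d:λ_d)}} / (∂x^{i_{τ(N)}} ⋯ ∂x^{i_{τ(κ)}} (∂y)^{μ_1 + ⋯ + μ_d - 1})`.
It is used for `1 ≤ N ≤ κ + 1` only. -/
noncomputable def termX (𝒳 : Fin n → Base 𝕜 n → 𝕜) (i : Fin κ → Fin n)
    (k : Pos d lam mu → Fin n) (σ : Equiv.Perm (Pos d lam mu)) (p : Base 𝕜 n) : 𝕜 :=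
  if h : weight lam mu - 1 ≤ κ ∧ weight lam mu - 1 < weight lam mu then
    ∑ τ ∈ shuffles κ (weight lam mu - 1),
      kron (firstPart (weight lam mu - 1) h.1 (i ∘ τ))
          (firstPart (weight lam mu - 1) h.2.le (permuted k σ)) 𝕜 *
        partialXY (lastPart (weight lam mu - 1) (i ∘ τ)) ((∑ e, mu e) - 1)
          (𝒳 (permuted k σ ⟨weight lam mu - 1, h.2⟩)) p
  else 0

open scoped Classical in
/-- The strictly increasing `d`-tuples `1 ≤ λ_1 < ⋯ < λ_d ≤ κ`. -/
noncomputable def lambdas (κ d : ℕ) : Finset (Fin d → ℕ) :=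
  (Fintype.piFinset fun _ => Finset.Icc 1 κ).filter StrictMono

/-- The `d`-tuples `μ_1 ≥ 1, …, μ_d ≥ 1` with `μ_1 λ_1 + ⋯ + μ_d λ_d ≤ κ + 1`. The bound
`μ_e ≤ κ + 1` follows from this inequality when all `λ_e ≥ 1`. -/
def mus (κ : ℕ) {d : ℕ} (lam : Fin d → ℕ) : Finset (Fin d → ℕ) :=
  (Fintype.piFinset fun _ => Finset.Icc 1 (κ + 1)).filter fun mu => weight lam mu ≤ κ + 1

/-- The right-hand side of the explicit formula, for given sets `F d λ μ` of representatives
`σ`. -/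
noncomputable def explicitRHS (𝒳 : Fin n → Base 𝕜 n → 𝕜) (𝒴 : Base 𝕜 n → 𝕜)
    (F : (d : ℕ) → (lam mu : Fin d → ℕ) → Finset (Equiv.Perm (Pos d lam mu)))
    (κ : ℕ) (i : Fin κ → Fin n) (p : Jet 𝕜 n) : 𝕜 :=
  partialXY i 0 𝒴 (Jet.base p) +
    ∑ d ∈ Finset.Icc 1 (κ + 1), ∑ lam ∈ lambdas κ d, ∑ mu ∈ mus κ lam,
      ∑ k : Pos d lam mu → Fin n,
        (∑ σ ∈ F d lam mu, termY 𝒴 i k σ (Jet.base p) -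
          ∑ σ ∈ F d lam mu, termX 𝒳 i k σ (Jet.base p)) *
        jetMonomial p.2 k

end Formula

end LieProlongation

open LieProlongation

namespace LieProlongation

/-! ### Partial derivatives of smooth functions -/

section Smooth

variable {𝕜 : Type*} [RCLike 𝕜] {E : Type*} [NormedAddCommGroup E] [NormedSpace 𝕜 E]

/-! Give the κ differentiations distinct labels 1, …, κ. By the Leibniz rule, D_a applied to a
product (∂_A ∂_y^b f) · ∏ y_B does one of three things. It differentiates f in x^a (a joins A), it
differentiates f in y and creates a factor y_a (a becomes a new block), or it differentiates a
factor y_B (a joins the block B). A term is thus recorded by a `State`: a set A of labels and a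
family of blocks on the other labels. The number of y-derivatives on 𝒴 is the number of blocks.

The recursion amounts to 𝐘_I = D_I(𝒴 - ∑ 𝒳ᵏ y_k) + ∑ 𝒳ᵏ y_{I,k}. The 𝒳-terms therefore evolve in the
same way from the single block {k}, with one y-derivative fewer than blocks, and the state whose
only block contains every label is left out. Its jet variable would exceed the order seen by
D^{κ+1}, which is why the recursion works with `properExtensions` (`prolong_eq_sum_stateTerm`).

With distinct labels each state arises exactly once: removing the last label recovers its
predecessor. The terms are thus indexed by a subset A and a set partition of its complement
(`mem_extensions_iff`, `nodup_extensions`). Repeated indices i_a cause no trouble, since labels are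
replaced by indices only afterwards. For the 𝒳-terms an additional label `none` stands for k and
must lie in a block (`prolong_eq_sum_states`).

The formula enumerates the same states. The block sizes determine λ and μ uniquely. A shuffle τ is
the same as the set A, with the remaining labels written in increasing order. A permutation σ
distributes this word over the triples, and two permutations give the same blocks exactly when they
lie in the same coset of ℌ (`sum_representatives`). The Kronecker symbols select the corresponding
k; in the 𝒳-sum the last letter stays free and is the marked label. Summing over shapes
(`sum_shapes`) gives the identity.

The order of ℌ is that of a product of wreath products: blocks of equal size are permuted, and so
are the entries within each block. -/

theorem contDiff_lineDeriv {f : E → 𝕜} (hf : ContDiff 𝕜 ∞ f) (v : E) :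
    ContDiff 𝕜 ∞ fun p => lineDeriv 𝕜 f p v := by
  have h : (fun p => lineDeriv 𝕜 f p v) = fun p => fderiv 𝕜 f p v := by
    funext p
    exact (hf.differentiable (by simp) p).lineDeriv_eq_fderiv
  rw [h]
  exact (hf.fderiv_right (m := ∞) (by simp)).clm_apply contDiff_const

theorem lineDeriv_comm {f : E → 𝕜} (hf : ContDiff 𝕜 ∞ f) (v w : E) :
    (fun p => lineDeriv 𝕜 (fun q => lineDeriv 𝕜 f q w) p v) =
      fun p => lineDeriv 𝕜 (fun q => lineDeriv 𝕜 f q v) p w := by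
  have key : ∀ v w : E, ∀ p, lineDeriv 𝕜 (fun q => lineDeriv 𝕜 f q w) p v =
      fderiv 𝕜 (fderiv 𝕜 f) p v w := by
    intro v w p
    have h : (fun q => lineDeriv 𝕜 f q w) = fun q => fderiv 𝕜 f q w := by
      funext q
      exact (hf.differentiable (by simp) q).lineDeriv_eq_fderiv
    have hd : DifferentiableAt 𝕜 (fderiv 𝕜 f) p :=
      ((hf.fderiv_right (m := ∞) (by simp)).differentiable (by simp)) p
    rw [h, (hd.clm_apply (differentiableAt_const w)).lineDeriv_eq_fderiv,
      fderiv_clm_apply hd (differentiableAt_const w)]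
    simp
  funext p
  rw [key, key]
  refine (ContDiffAt.isSymmSndFDerivAt (n := ∞) hf.contDiffAt ?_) v w
  -- Over ℝ and ℂ, symmetry of the second derivative needs smoothness of order 2 only.
  simp only [minSmoothness_of_isRCLikeNormedField]
  exact ENat.LEInfty.out

end Smooth

section Partial

variable {𝕜 : Type*} [RCLike 𝕜] {n : ℕ} {f : Base 𝕜 n → 𝕜}

theorem contDiff_dx (i : Fin n) (hf : ContDiff 𝕜 ∞ f) : ContDiff 𝕜 ∞ (dx i f) :=
  contDiff_lineDeriv hf _

theorem contDiff_dy (hf : ContDiff 𝕜 ∞ f) : ContDiff 𝕜 ∞ (dy f) :=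
  contDiff_lineDeriv hf _

theorem contDiff_iterate_dy (b : ℕ) (hf : ContDiff 𝕜 ∞ f) : ContDiff 𝕜 ∞ (dy^[b] f) := by
  induction b generalizing f with
  | zero => exact hf
  | succ b ih => exact ih (contDiff_dy hf)

theorem contDiff_foldr_dx (l : List (Fin n)) (hf : ContDiff 𝕜 ∞ f) :
    ContDiff 𝕜 ∞ (l.foldr dx f) := by
  induction l with
  | nil => exact hf
  | cons a l ih => exact contDiff_dx a ih

theorem dx_dx_comm (i j : Fin n) (hf : ContDiff 𝕜 ∞ f) : dx i (dx j f) = dx j (dx i f) :=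
  lineDeriv_comm hf _ _

theorem dx_dy_comm (i : Fin n) (hf : ContDiff 𝕜 ∞ f) : dx i (dy f) = dy (dx i f) :=
  lineDeriv_comm hf _ _

theorem foldr_dx_perm {l l' : List (Fin n)} (h : l.Perm l') (hf : ContDiff 𝕜 ∞ f) :
    l.foldr dx f = l'.foldr dx f := by
  induction h with
  | nil => rfl
  | cons a _ ih => simp [ih]
  | swap a b l => exact dx_dx_comm _ _ (contDiff_foldr_dx l hf)
  | trans _ _ ih₁ ih₂ => exact ih₁.trans ih₂

theorem dy_foldr_dx (l : List (Fin n)) (hf : ContDiff 𝕜 ∞ f) :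
    dy (l.foldr dx f) = l.foldr dx (dy f) := by
  induction l with
  | nil => rfl
  | cons a l ih => simp [← ih, dx_dy_comm a (contDiff_foldr_dx l hf)]

/-- The partial derivative of `f` with respect to the variables `xⁱ`, `i ∈ A`, and `b` times with
respect to `y`. -/
noncomputable def partialMultiset (f : Base 𝕜 n → 𝕜) (A : Multiset (Fin n)) (b : ℕ) :
    Base 𝕜 n → 𝕜 :=
  A.toList.foldr dx (dy^[b] f)

/-- Partial derivatives commute, so the order chosen by `toList` is immaterial. -/
theorem partialMultiset_coe (hf : ContDiff 𝕜 ∞ f) (l : List (Fin n)) (b : ℕ) :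
    partialMultiset f (l : Multiset (Fin n)) b = l.foldr dx (dy^[b] f) :=
  foldr_dx_perm (Multiset.coe_eq_coe.1 (by simp)) (contDiff_iterate_dy b hf)

theorem contDiff_partialMultiset (hf : ContDiff 𝕜 ∞ f) (A : Multiset (Fin n)) (b : ℕ) :
    ContDiff 𝕜 ∞ (partialMultiset f A b) :=
  contDiff_foldr_dx _ (contDiff_iterate_dy b hf)

theorem dx_partialMultiset (hf : ContDiff 𝕜 ∞ f) (i : Fin n) (A : Multiset (Fin n)) (b : ℕ) :
    dx i (partialMultiset f A b) = partialMultiset f (i ::ₘ A) b := by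
  induction A using Quotient.inductionOn with
  | h l =>
    simp only [Multiset.quot_mk_to_coe, Multiset.cons_coe]
    rw [partialMultiset_coe hf, partialMultiset_coe hf, List.foldr_cons]

theorem dy_partialMultiset (hf : ContDiff 𝕜 ∞ f) (A : Multiset (Fin n)) (b : ℕ) :
    dy (partialMultiset f A b) = partialMultiset f A (b + 1) := by
  rw [partialMultiset, partialMultiset, dy_foldr_dx _ (contDiff_iterate_dy b hf),
    Function.iterate_succ_apply']

theorem partialXY_eq (hf : ContDiff 𝕜 ∞ f) {r : ℕ} (j : Fin r → Fin n) (b : ℕ) :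
    partialXY j b f = partialMultiset f (tuple j) b := by
  have h : tuple j = (List.ofFn j : Multiset (Fin n)) := by
    simp [tuple, Fin.univ_val_map]
  rw [h, partialMultiset_coe hf]
  rfl

end Partial

/-! ### Total differentiation as a derivation -/

section Total

variable {𝕜 : Type*} [RCLike 𝕜] {n : ℕ}

/-- Existence at `p` of all the partial derivatives of `F` along the coordinates of the jet
space. -/
def JetDiffAt (F : Jet 𝕜 n → 𝕜) (p : Jet 𝕜 n) : Prop :=
  (∀ i : Fin n, LineDifferentiableAt 𝕜 F p (Pi.single i 1, 0)) ∧
    ∀ M : Multiset (Fin n), LineDifferentiableAt 𝕜 F p (0, Pi.single M 1)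

section Line

variable {E : Type*} [AddCommGroup E] [Module 𝕜 E] {F G : E → 𝕜} {p v : E}

/-- The jet space is a product over all multisets and carries no norm, so the rules of calculus are
obtained by restriction to lines, where they are one-variable statements. -/
theorem hasLineDerivAt_mul {a b : 𝕜} (hF : HasLineDerivAt 𝕜 F a p v)
    (hG : HasLineDerivAt 𝕜 G b p v) :
    HasLineDerivAt 𝕜 (fun q => F q * G q) (a * G p + F p * b) p v := by
  have h := HasDerivAt.mul (hF : HasDerivAt _ _ _) (hG : HasDerivAt _ _ _)
  simp only [zero_smul, add_zero] at h
  exact h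

theorem hasLineDerivAt_add {a b : 𝕜} (hF : HasLineDerivAt 𝕜 F a p v)
    (hG : HasLineDerivAt 𝕜 G b p v) :
    HasLineDerivAt 𝕜 (fun q => F q + G q) (a + b) p v :=
  HasDerivAt.add (hF : HasDerivAt _ _ _) (hG : HasDerivAt _ _ _)

theorem hasLineDerivAt_sub {a b : 𝕜} (hF : HasLineDerivAt 𝕜 F a p v)
    (hG : HasLineDerivAt 𝕜 G b p v) :
    HasLineDerivAt 𝕜 (fun q => F q - G q) (a - b) p v :=
  HasDerivAt.sub (hF : HasDerivAt _ _ _) (hG : HasDerivAt _ _ _)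

theorem hasLineDerivAt_const' (c : 𝕜) : HasLineDerivAt 𝕜 (fun _ : E => c) 0 p v :=
  hasDerivAt_const _ _

end Line

variable {F G : Jet 𝕜 n → 𝕜} {p : Jet 𝕜 n}

theorem JetDiffAt.mul (hF : JetDiffAt F p) (hG : JetDiffAt G p) :
    JetDiffAt (fun q => F q * G q) p :=
  ⟨fun i => (hasLineDerivAt_mul (hF.1 i).hasLineDerivAt
      (hG.1 i).hasLineDerivAt).lineDifferentiableAt,
    fun M => (hasLineDerivAt_mul (hF.2 M).hasLineDerivAt
      (hG.2 M).hasLineDerivAt).lineDifferentiableAt⟩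

theorem JetDiffAt.add (hF : JetDiffAt F p) (hG : JetDiffAt G p) :
    JetDiffAt (fun q => F q + G q) p :=
  ⟨fun i => (hasLineDerivAt_add (hF.1 i).hasLineDerivAt
      (hG.1 i).hasLineDerivAt).lineDifferentiableAt,
    fun M => (hasLineDerivAt_add (hF.2 M).hasLineDerivAt
      (hG.2 M).hasLineDerivAt).lineDifferentiableAt⟩

theorem jetDiffAt_const (c : 𝕜) : JetDiffAt (fun _ : Jet 𝕜 n => c) p :=
  ⟨fun _ => (hasLineDerivAt_const' c).lineDifferentiableAt,
    fun _ => (hasLineDerivAt_const' c).lineDifferentiableAt⟩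

theorem totalD_const (a : ℕ) (i : Fin n) (c : 𝕜) : totalD a i (fun _ : Jet 𝕜 n => c) p = 0 := by
  simp only [totalD, jetDx, jetDy, (hasLineDerivAt_const' c).lineDeriv, mul_zero,
    Finset.sum_const_zero, add_zero]

theorem totalD_mul (a : ℕ) (i : Fin n) (hF : JetDiffAt F p) (hG : JetDiffAt G p) :
    totalD a i (fun q => F q * G q) p = totalD a i F p * G p + F p * totalD a i G p := by
  have h1 : jetDx i (fun q => F q * G q) p = jetDx i F p * G p + F p * jetDx i G p :=
    (hasLineDerivAt_mul (hF.1 i).hasLineDerivAt (hG.1 i).hasLineDerivAt).lineDeriv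
  have h2 : ∀ M, jetDy M (fun q => F q * G q) p = jetDy M F p * G p + F p * jetDy M G p :=
    fun M => (hasLineDerivAt_mul (hF.2 M).hasLineDerivAt (hG.2 M).hasLineDerivAt).lineDeriv
  simp only [totalD, h1, h2, add_mul, mul_add, Finset.sum_mul, Finset.mul_sum,
    Finset.sum_add_distrib]
  simp only [mul_assoc, mul_left_comm]
  ring

theorem totalD_add (a : ℕ) (i : Fin n) (hF : JetDiffAt F p) (hG : JetDiffAt G p) :
    totalD a i (fun q => F q + G q) p = totalD a i F p + totalD a i G p := by
  have h1 : jetDx i (fun q => F q + G q) p = jetDx i F p + jetDx i G p :=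
    (hasLineDerivAt_add (hF.1 i).hasLineDerivAt (hG.1 i).hasLineDerivAt).lineDeriv
  have h2 : ∀ M, jetDy M (fun q => F q + G q) p = jetDy M F p + jetDy M G p :=
    fun M => (hasLineDerivAt_add (hF.2 M).hasLineDerivAt (hG.2 M).hasLineDerivAt).lineDeriv
  simp only [totalD, h1, h2, mul_add, Finset.sum_add_distrib]
  ring

theorem totalD_sub (a : ℕ) (i : Fin n) (hF : JetDiffAt F p) (hG : JetDiffAt G p) :
    totalD a i (fun q => F q - G q) p = totalD a i F p - totalD a i G p := by
  have h1 : jetDx i (fun q => F q - G q) p = jetDx i F p - jetDx i G p :=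
    (hasLineDerivAt_sub (hF.1 i).hasLineDerivAt (hG.1 i).hasLineDerivAt).lineDeriv
  have h2 : ∀ M, jetDy M (fun q => F q - G q) p = jetDy M F p - jetDy M G p :=
    fun M => (hasLineDerivAt_sub (hF.2 M).hasLineDerivAt (hG.2 M).hasLineDerivAt).lineDeriv
  simp only [totalD, h1, h2, mul_sub, Finset.sum_sub_distrib]
  ring

theorem jetDiffAt_multiset_sum {S : Type*} (m : Multiset S) (Φ : S → Jet 𝕜 n → 𝕜)
    (h : ∀ s ∈ m, JetDiffAt (Φ s) p) : JetDiffAt (fun q => (m.map fun s => Φ s q).sum) p := by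
  induction m using Multiset.induction with
  | empty => simpa using jetDiffAt_const 0
  | cons s m ih =>
    simp only [Multiset.map_cons, Multiset.sum_cons]
    exact (h s (by simp)).add (ih fun t ht => h t (by simp [ht]))

theorem totalD_multiset_sum {S : Type*} (a : ℕ) (i : Fin n) (m : Multiset S)
    (Φ : S → Jet 𝕜 n → 𝕜) (h : ∀ s ∈ m, JetDiffAt (Φ s) p) :
    totalD a i (fun q => (m.map fun s => Φ s q).sum) p =
      (m.map fun s => totalD a i (Φ s) p).sum := by
  induction m using Multiset.induction with
  | empty => simpa using totalD_const a i 0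
  | cons s m ih =>
    simp only [Multiset.map_cons, Multiset.sum_cons]
    rw [totalD_add a i (h s (by simp))
      (jetDiffAt_multiset_sum m Φ fun t ht => h t (by simp [ht])),
      ih fun t ht => h t (by simp [ht])]

theorem jetDiffAt_finset_sum {S : Type*} (m : Finset S) (Φ : S → Jet 𝕜 n → 𝕜)
    (h : ∀ s ∈ m, JetDiffAt (Φ s) p) : JetDiffAt (fun q => ∑ s ∈ m, Φ s q) p :=
  jetDiffAt_multiset_sum m.val Φ h

theorem totalD_finset_sum {S : Type*} (a : ℕ) (i : Fin n) (m : Finset S)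
    (Φ : S → Jet 𝕜 n → 𝕜) (h : ∀ s ∈ m, JetDiffAt (Φ s) p) :
    totalD a i (fun q => ∑ s ∈ m, Φ s q) p = ∑ s ∈ m, totalD a i (Φ s) p :=
  totalD_multiset_sum a i m.val Φ h

/-- The double sum in `totalD` meets every multiset of fewer than a elements exactly once. -/
theorem sum_range_sum_sym (a : ℕ) (B : Multiset (Fin n)) (hB : B.card < a)
    (g : Multiset (Fin n) → 𝕜) (hg : ∀ M, M ≠ B → g M = 0) :
    ∑ l ∈ Finset.range a, ∑ M : Sym (Fin n) l, g (M : Multiset (Fin n)) = g B := by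
  rw [Finset.sum_eq_single_of_mem B.card (Finset.mem_range.2 hB),
    Finset.sum_eq_single_of_mem (Sym.mk B rfl : Sym (Fin n) B.card) (Finset.mem_univ _)]
  · rfl
  · intro M _ hM
    exact hg _ fun h => hM (Subtype.ext h)
  · intro l _ hl
    refine Finset.sum_eq_zero fun M _ => hg _ fun h => hl ?_
    rw [← h]
    exact M.2.symm

theorem hasLineDerivAt_coord_dx (B : Multiset (Fin n)) (i : Fin n) :
    HasLineDerivAt 𝕜 (fun q : Jet 𝕜 n => q.2 B) 0 p (Pi.single i 1, 0) := by
  simpa [HasLineDerivAt] using hasDerivAt_const (0 : 𝕜) (p.2 B)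

theorem hasLineDerivAt_coord_dy (B M : Multiset (Fin n)) :
    HasLineDerivAt 𝕜 (fun q : Jet 𝕜 n => q.2 B) (if M = B then 1 else 0) p
      (0, Pi.single M 1) := by
  by_cases h : M = B
  · subst h
    simpa [HasLineDerivAt] using (hasDerivAt_id (0 : 𝕜)).const_add (p.2 M)
  · simpa [HasLineDerivAt, h, Ne.symm h] using hasDerivAt_const (0 : 𝕜) (p.2 B)

theorem jetDiffAt_coord (B : Multiset (Fin n)) : JetDiffAt (fun q : Jet 𝕜 n => q.2 B) p :=
  ⟨fun i => (hasLineDerivAt_coord_dx B i).lineDifferentiableAt,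
    fun M => (hasLineDerivAt_coord_dy B M).lineDifferentiableAt⟩

theorem totalD_coord {a : ℕ} (i : Fin n) (B : Multiset (Fin n)) (hB : B.card < a) :
    totalD a i (fun q : Jet 𝕜 n => q.2 B) p = p.2 (i ::ₘ B) := by
  simp only [totalD, jetDx, jetDy, (hasLineDerivAt_coord_dx B i).lineDeriv,
    (hasLineDerivAt_coord_dy B _).lineDeriv]
  rw [sum_range_sum_sym a B hB fun M => p.2 (i ::ₘ M) * if M = B then 1 else 0]
  · simp
  · intro M hM
    simp [hM]

theorem hasLineDerivAt_lift_dx {g : Base 𝕜 n → 𝕜} (hg : ContDiff 𝕜 ∞ g) (i : Fin n) :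
    HasLineDerivAt 𝕜 (lift g) (dx i g p.base) p (Pi.single i 1, 0) := by
  have h : HasLineDerivAt 𝕜 g (dx i g p.base) p.base (Pi.single i 1, 0) :=
    ((hg.differentiable (by simp)) p.base).lineDifferentiableAt.hasLineDerivAt
  simpa [HasLineDerivAt, LieProlongation.lift, Jet.base] using h

theorem hasLineDerivAt_lift_dy {g : Base 𝕜 n → 𝕜} (hg : ContDiff 𝕜 ∞ g)
    (M : Multiset (Fin n)) :
    HasLineDerivAt 𝕜 (lift g) (if M = 0 then dy g p.base else 0) p (0, Pi.single M 1) := by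
  by_cases hM : M = 0
  · have h : HasLineDerivAt 𝕜 g (dy g p.base) p.base (0, 1) :=
      ((hg.differentiable (by simp)) p.base).lineDifferentiableAt.hasLineDerivAt
    simpa [hM, HasLineDerivAt, LieProlongation.lift, Jet.base] using h
  · simpa [hM, Ne.symm hM, HasLineDerivAt, LieProlongation.lift, Jet.base] using
      hasDerivAt_const (0 : 𝕜) (g p.base)

theorem jetDiffAt_lift {g : Base 𝕜 n → 𝕜} (hg : ContDiff 𝕜 ∞ g) : JetDiffAt (lift g) p :=
  ⟨fun i => (hasLineDerivAt_lift_dx hg i).lineDifferentiableAt,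
    fun M => (hasLineDerivAt_lift_dy hg M).lineDifferentiableAt⟩

theorem totalD_lift {a : ℕ} (ha : 0 < a) (i : Fin n) {g : Base 𝕜 n → 𝕜}
    (hg : ContDiff 𝕜 ∞ g) :
    totalD a i (lift g) p = dx i g p.base + p.2 {i} * dy g p.base := by
  simp only [totalD, jetDx, jetDy, (hasLineDerivAt_lift_dx hg i).lineDeriv,
    (hasLineDerivAt_lift_dy hg _).lineDeriv]
  rw [sum_range_sum_sym a 0 (by simpa using ha)
    fun M => p.2 (i ::ₘ M) * if M = 0 then dy g p.base else 0]
  · simp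
  · intro M hM
    simp [hM]

theorem jetDiffAt_monomial (β : Multiset (Multiset (Fin n))) :
    JetDiffAt (fun q : Jet 𝕜 n => (β.map q.2).prod) p := by
  induction β using Multiset.induction with
  | empty => simpa using jetDiffAt_const 1
  | cons B β ih =>
    simp only [Multiset.map_cons, Multiset.prod_cons]
    exact (jetDiffAt_coord B).mul ih

/-- Leibniz rule. The bound on block sizes ensures that the truncated operator differentiates every
factor. -/
theorem totalD_monomial {a : ℕ} (i : Fin n) (β : Multiset (Multiset (Fin n)))
    (hβ : ∀ B ∈ β, B.card < a) :
    totalD a i (fun q : Jet 𝕜 n => (β.map q.2).prod) p =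
      (β.map fun B => (((i ::ₘ B) ::ₘ β.erase B).map p.2).prod).sum := by
  induction β using Multiset.induction with
  | empty => simpa using totalD_const a i 1
  | cons B β ih =>
    have hB := hβ B (by simp)
    have e : (β.map fun C => (((i ::ₘ C) ::ₘ (B ::ₘ β).erase C).map p.2).prod) =
        β.map fun C => p.2 B * (((i ::ₘ C) ::ₘ β.erase C).map p.2).prod := by
      refine Multiset.map_congr rfl fun C hC => ?_
      rw [Multiset.erase_cons_tail_of_mem hC]
      simp only [Multiset.map_cons, Multiset.prod_cons]
      ring
    simp only [Multiset.map_cons, Multiset.prod_cons, Multiset.sum_cons,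
      Multiset.erase_cons_head]
    rw [totalD_mul a i (jetDiffAt_coord B) (jetDiffAt_monomial β), totalD_coord i B hB,
      ih fun C hC => hβ C (by simp [hC])]
    simp only [Multiset.map_cons, Multiset.prod_cons] at e
    rw [e, Multiset.sum_map_mul_left]
    simp only [Multiset.map_cons, Multiset.prod_cons]

end Total

/-! ### The terms produced by repeated total differentiation -/

/-- A multiset of labels of derivatives with respect to the `xⁱ`, and a multiset of blocks, each of
which labels a jet variable. -/
abbrev State (α : Type*) : Type _ := Multiset α × Multiset (Multiset α)

namespace State

variable {α β : Type*} [DecidableEq α] [DecidableEq β]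

/-- The states obtained by adding the label `a`: as a derivative with respect to `x`, as a new
block, or as an element of one of the blocks. -/
def step (a : α) (s : State α) : Multiset (State α) :=
  (a ::ₘ s.1, s.2) ::ₘ (s.1, {a} ::ₘ s.2) ::ₘ s.2.map fun B => (s.1, (a ::ₘ B) ::ₘ s.2.erase B)

/-- The states obtained from `s₀` by adding all the labels of a list. -/
def extensions (s₀ : State α) : List α → Multiset (State α)
  | [] => {s₀}
  | a :: l => (extensions s₀ l).bind (step a)

/-- The extensions of the state with the single block `{k}`, except for the one whose only block
contains all the labels. -/
def properExtensions (k : α) : List α → Multiset (State α)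
  | [] => 0
  | a :: l => (properExtensions k l).bind (step a) +
      {(({a} : Multiset α), ({k ::ₘ (l : Multiset α)} : Multiset (Multiset α))),
        (0, {a} ::ₘ {k ::ₘ (l : Multiset α)})}

/-- The state obtained by renaming the labels. -/
def map (f : α → β) (s : State α) : State β := (s.1.map f, s.2.map (Multiset.map f))

theorem mem_step {a : α} {s t : State α} :
    t ∈ step a s ↔ t = (a ::ₘ s.1, s.2) ∨ t = (s.1, {a} ::ₘ s.2) ∨
      ∃ B ∈ s.2, t = (s.1, (a ::ₘ B) ::ₘ s.2.erase B) := by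
  simp only [step, Multiset.mem_cons, Multiset.mem_map, eq_comm]

/-- The renaming need not be injective: multisets of states keep multiplicities, so coinciding
indices do not merge terms. -/
theorem map_step (f : α → β) (a : α) (s : State α) :
    (step a s).map (map f) = step (f a) (map f s) := by
  simp only [step, map, Multiset.map_cons, Multiset.map_map, Function.comp_apply,
    Multiset.map_singleton]
  congr 2
  refine Multiset.map_congr rfl fun B hB => ?_
  simp only [Function.comp_apply, map, Multiset.map_cons, Multiset.map_erase_of_mem _ _ hB]

theorem map_extensions (f : α → β) (s₀ : State α) (l : List α) :
    (extensions s₀ l).map (map f) = extensions (map f s₀) (l.map f) := by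
  induction l with
  | nil => simp [extensions]
  | cons a l ih =>
    rw [extensions, List.map_cons, extensions, ← ih, Multiset.map_bind, Multiset.bind_map]
    exact Multiset.bind_congr fun s _ => map_step f a s

theorem map_properExtensions (f : α → β) (k : α) (l : List α) :
    (properExtensions k l).map (map f) = properExtensions (f k) (l.map f) := by
  induction l with
  | nil => rfl
  | cons a l ih =>
    rw [properExtensions, List.map_cons, properExtensions, ← ih, Multiset.map_add,
      Multiset.map_bind, Multiset.bind_map]
    congr 1
    exact Multiset.bind_congr fun s _ => map_step f a s

/-- Of the three successors of the state with one full block, two are the pair added in the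
recursion for `properExtensions` and the third is the next full block. -/
theorem properExtensions_add (k : α) (l : List α) :
    properExtensions k l + {(0, {k ::ₘ (l : Multiset α)})} = extensions (0, {{k}}) l := by
  induction l with
  | nil => simp [extensions, properExtensions]
  | cons a l ih =>
    rw [extensions, ← ih, Multiset.add_bind, Multiset.singleton_bind, properExtensions, add_assoc]
    congr 1
    simp only [step, Multiset.map_singleton, Multiset.erase_singleton, ← Multiset.cons_coe]
    rw [Multiset.cons_swap k a]
    rfl

theorem card_block_le_of_mem_step {a : α} {m : ℕ} {s t : State α} (h : ∀ B ∈ s.2, B.card ≤ m)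
    (ht : t ∈ step a s) : ∀ B ∈ t.2, B.card ≤ m + 1 := by
  have h' : ∀ B ∈ s.2, B.card ≤ m + 1 := fun B hB => (h B hB).trans (Nat.le_succ m)
  rcases mem_step.1 ht with rfl | rfl | ⟨C, hC, rfl⟩
  · exact h'
  · intro B hB
    rcases Multiset.mem_cons.1 hB with rfl | hB
    · simp
    · exact h' B hB
  · intro B hB
    rcases Multiset.mem_cons.1 hB with rfl | hB
    · simpa using h C hC
    · exact h' B (Multiset.mem_of_mem_erase hB)

theorem card_le_card_of_mem_step {a : α} {s t : State α} (ht : t ∈ step a s) :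
    s.2.card ≤ t.2.card := by
  rcases mem_step.1 ht with rfl | rfl | ⟨C, hC, rfl⟩
  · exact le_rfl
  · simp
  · rw [Multiset.card_cons, Multiset.card_erase_add_one hC]

theorem card_block_le_of_mem_extensions {l : List α} {s : State α}
    (hs : s ∈ extensions (0, 0) l) : ∀ B ∈ s.2, B.card ≤ l.length := by
  induction l generalizing s with
  | nil =>
    rw [extensions, Multiset.mem_singleton] at hs
    simp [hs]
  | cons a l ih =>
    obtain ⟨t, ht, hst⟩ := Multiset.mem_bind.1 hs
    exact card_block_le_of_mem_step (ih ht) hst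

/-- Only the omitted state has a block of size `l.length + 1`, so the next total derivative sees all
the jet variables that occur. -/
theorem card_block_le_of_mem_properExtensions {k : α} {l : List α} {s : State α}
    (hs : s ∈ properExtensions k l) : ∀ B ∈ s.2, B.card ≤ l.length := by
  induction l generalizing s with
  | nil => simp [properExtensions] at hs
  | cons a l ih =>
    rcases Multiset.mem_add.1 hs with hs | hs
    · obtain ⟨t, ht, hst⟩ := Multiset.mem_bind.1 hs
      exact card_block_le_of_mem_step (ih ht) hst
    · simp only [Multiset.insert_eq_cons, Multiset.mem_cons, Multiset.mem_singleton] at hs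
      rcases hs with rfl | rfl <;> simp

/-- This makes the truncated subtraction of 1 in the y-order of the 𝒳-terms harmless. -/
theorem one_le_card_of_mem_properExtensions {k : α} {l : List α} {s : State α}
    (hs : s ∈ properExtensions k l) : 1 ≤ s.2.card := by
  induction l generalizing s with
  | nil => simp [properExtensions] at hs
  | cons a l ih =>
    rcases Multiset.mem_add.1 hs with hs | hs
    · obtain ⟨t, ht, hst⟩ := Multiset.mem_bind.1 hs
      exact (ih ht).trans (card_le_card_of_mem_step hst)
    · simp only [Multiset.insert_eq_cons, Multiset.mem_cons, Multiset.mem_singleton] at hs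
      rcases hs with rfl | rfl <;> simp

end State

/-! ### The function attached to a state and its total derivative -/

section Term

variable {𝕜 : Type*} [RCLike 𝕜] {n : ℕ}

/-- The product of the derivative of `f` of type `s.1` in the `xⁱ`, and of order `c` less than the
number of blocks in `y`, by the jet variables labelled by the blocks of `s`. -/
noncomputable def stateTerm (f : Base 𝕜 n → 𝕜) (c : ℕ) (s : State (Fin n)) (p : Jet 𝕜 n) : 𝕜 :=
  partialMultiset f s.1 (s.2.card - c) p.base * (s.2.map p.2).prod

variable {f : Base 𝕜 n → 𝕜} {p : Jet 𝕜 n}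

theorem jetDiffAt_stateTerm (hf : ContDiff 𝕜 ∞ f) (c : ℕ) (s : State (Fin n)) :
    JetDiffAt (stateTerm f c s) p :=
  (jetDiffAt_lift (contDiff_partialMultiset hf s.1 (s.2.card - c))).mul (jetDiffAt_monomial s.2)

/-- Leibniz rule: the three kinds of successors in `step` are the x-derivative of the coefficient,
its y-derivative, and the derivative of one jet variable. -/
theorem totalD_stateTerm (hf : ContDiff 𝕜 ∞ f) {a c : ℕ} (ha : 0 < a) (i : Fin n)
    {s : State (Fin n)} (hs : ∀ B ∈ s.2, B.card < a) (hc : c ≤ s.2.card) :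
    totalD a i (stateTerm f c s) p = ((s.step i).map fun t => stateTerm f c t p).sum := by
  have hg := contDiff_partialMultiset hf s.1 (s.2.card - c)
  have e : (s.2.map fun B => stateTerm f c (s.1, (i ::ₘ B) ::ₘ s.2.erase B) p) =
      s.2.map fun B => partialMultiset f s.1 (s.2.card - c) p.base *
        (((i ::ₘ B) ::ₘ s.2.erase B).map p.2).prod := by
    refine Multiset.map_congr rfl fun B hB => ?_
    simp only [stateTerm, Multiset.card_cons, Multiset.card_erase_add_one hB]
  have h := totalD_mul a i (p := p) (jetDiffAt_lift hg) (jetDiffAt_monomial s.2)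
  rw [totalD_lift ha i hg, totalD_monomial i s.2 hs, dx_partialMultiset hf,
    dy_partialMultiset hf] at h
  refine h.trans ?_
  simp only [State.step, Multiset.map_cons, Multiset.sum_cons, Multiset.map_map,
    Function.comp_def]
  rw [e, Multiset.sum_map_mul_left]
  simp only [stateTerm, Multiset.card_cons, Multiset.map_cons, Multiset.prod_cons,
    LieProlongation.lift, Nat.sub_add_comm hc]
  ring

theorem totalD_sum_stateTerm (hf : ContDiff 𝕜 ∞ f) {a c : ℕ} (ha : 0 < a) (i : Fin n)
    {m : Multiset (State (Fin n))} (hm : ∀ s ∈ m, ∀ B ∈ s.2, B.card < a)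
    (hc : ∀ s ∈ m, c ≤ s.2.card) :
    totalD a i (fun q => (m.map fun s => stateTerm f c s q).sum) p =
      ((m.bind (State.step i)).map fun t => stateTerm f c t p).sum := by
  rw [totalD_multiset_sum a i m (stateTerm f c) fun s _ => jetDiffAt_stateTerm hf c s,
    Multiset.map_bind, Multiset.sum_bind]
  exact congrArg _ (Multiset.map_congr rfl fun s hs =>
    totalD_stateTerm hf ha i (hm s hs) (hc s hs))

theorem tuple_eq_coe {α : Type*} {l : ℕ} (k : Fin l → α) :
    tuple k = ((List.ofFn k).reverse : Multiset α) := by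
  simp [tuple, Fin.univ_val_map]

/-- Induction on κ. The list is reversed because the last index is differentiated last, while
`extensions` adds the head of its list last. -/
theorem prolong_eq_sum_stateTerm {𝒳 : Fin n → Base 𝕜 n → 𝕜} {𝒴 : Base 𝕜 n → 𝕜}
    (h𝒳 : ∀ k, ContDiff 𝕜 ∞ (𝒳 k)) (h𝒴 : ContDiff 𝕜 ∞ 𝒴) (κ : ℕ) (i : Fin κ → Fin n)
    (p : Jet 𝕜 n) :
    prolong 𝒳 𝒴 κ i p =
      ((State.extensions (0, 0) (List.ofFn i).reverse).map fun s => stateTerm 𝒴 0 s p).sum -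
        ∑ k, ((State.properExtensions k (List.ofFn i).reverse).map
          fun s => stateTerm (𝒳 k) 1 s p).sum := by
  induction κ generalizing p with
  | zero =>
    simp [prolong, State.extensions, State.properExtensions, stateTerm, partialMultiset,
      LieProlongation.lift]
  | succ κ ih =>
    set l := (List.ofFn (Fin.init i)).reverse with hl
    have hcons : (List.ofFn i).reverse = i (Fin.last κ) :: l := by
      rw [List.ofFn_succ', List.concat_eq_append, List.reverse_append]
      rfl
    have hlen : l.length = κ := by simp [hl]
    rw [prolong, funext (ih (Fin.init i)), hcons, State.extensions, ← hl]
    beta_reduce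
    have hJ : ∀ (g : Base 𝕜 n → 𝕜) (_ : ContDiff 𝕜 ∞ g) (c : ℕ) (m : Multiset (State (Fin n))),
        JetDiffAt (fun q => (m.map fun s => stateTerm g c s q).sum) p := fun g hg c m =>
      jetDiffAt_multiset_sum m _ fun s _ => jetDiffAt_stateTerm hg c s
    rw [totalD_sub _ _ (hJ _ h𝒴 0 _) (jetDiffAt_finset_sum _ _ fun k _ => hJ _ (h𝒳 k) 1 _),
      totalD_finset_sum _ _ _ _ fun k _ => hJ _ (h𝒳 k) 1 _,
      totalD_sum_stateTerm h𝒴 κ.succ_pos _ (fun s hs B hB => ?_) fun s _ => Nat.zero_le _,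
      sub_sub, ← Finset.sum_add_distrib]
    · congr 1
      refine Finset.sum_congr rfl fun k _ => ?_
      rw [totalD_sum_stateTerm (h𝒳 k) κ.succ_pos _ (fun s hs B hB => ?_)
        fun s hs => State.one_le_card_of_mem_properExtensions hs, State.properExtensions,
        Multiset.map_add, Multiset.sum_add, totalD_lift one_pos _ (h𝒳 k), tuple_eq_coe, ← hl]
      · congr 1
        -- The two states adjoined by `properExtensions` are the two terms of D¹(𝒳ᵏ) multiplied by
        -- y_{I,k}.
        have h1 := congrFun (dx_partialMultiset (h𝒳 k) (i (Fin.last κ)) 0 0) p.base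
        have h2 := congrFun (dy_partialMultiset (h𝒳 k) 0 0) p.base
        have h0 : partialMultiset (𝒳 k) 0 0 = 𝒳 k := by simp [partialMultiset]
        rw [h0] at h1 h2
        simp [stateTerm, h1, h2]
        ring
      · have := State.card_block_le_of_mem_properExtensions hs B hB
        omega
    · have := State.card_block_le_of_mem_extensions hs B hB
      omega

end Term

/-! ### Enumeration of the states on a set of labels -/

/-- Two equal nonempty blocks would share a label. -/
theorem nodup_of_nodup_join {α : Type*} {β : Multiset (Multiset α)} (h : β.join.Nodup)
    (h0 : 0 ∉ β) : β.Nodup := by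
  induction β using Multiset.induction with
  | empty => exact Multiset.nodup_zero
  | cons B β ih =>
    rw [Multiset.join_cons, Multiset.nodup_add] at h
    refine Multiset.nodup_cons.2 ⟨fun hB => ?_, ih h.2.1 fun h' => h0 (by simp [h'])⟩
    obtain ⟨x, hx⟩ := Multiset.exists_mem_of_ne_zero
      (fun hB0 : B = 0 => h0 (by simp [hB0]))
    exact Multiset.disjoint_left.1 h.2.2 hx (Multiset.mem_join.2 ⟨B, hB, hx⟩)

namespace State

variable {α : Type*} [DecidableEq α]

/-- The state from which `t` was obtained by adding the label `a`. -/
def parent (a : α) (t : State α) : State α :=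
  (t.1.erase a, (t.2.map fun B => B.erase a).filter (· ≠ 0))

/-- Since a is new and no block of s is empty, erasing a and discarding a block that becomes empty
undoes each kind of step. -/
theorem parent_of_mem_step {a : α} {s t : State α} (h1 : a ∉ s.1) (h2 : ∀ B ∈ s.2, a ∉ B)
    (h0 : 0 ∉ s.2) (ht : t ∈ step a s) : parent a t = s := by
  have key : ∀ γ ≤ s.2, (γ.map fun B => B.erase a).filter (· ≠ 0) = γ := by
    intro γ hγ
    have : (γ.map fun B => B.erase a) = γ :=
      (Multiset.map_congr rfl fun B hB =>
        Multiset.erase_of_notMem (h2 B (Multiset.mem_of_le hγ hB))).trans (Multiset.map_id' γ)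
    rw [this, Multiset.filter_eq_self]
    rintro B hB rfl
    exact h0 (Multiset.mem_of_le hγ hB)
  obtain ⟨A, β⟩ := s
  rcases mem_step.1 ht with rfl | rfl | ⟨B, hB, rfl⟩
  · simp only [parent, Multiset.erase_cons_head, key β le_rfl]
  · simp only [parent, Multiset.map_cons, Multiset.erase_singleton,
      Multiset.erase_of_notMem h1, ne_eq, not_true_eq_false, not_false_eq_true,
      Multiset.filter_cons_of_neg]
    rw [key β le_rfl]
  · have hB0 : B ≠ 0 := fun h => h0 (h ▸ hB)
    simp only [parent, Multiset.map_cons, Multiset.erase_cons_head,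
      Multiset.erase_of_notMem h1]
    rw [Multiset.filter_cons_of_pos (p := fun B : Multiset α => B ≠ 0) _ hB0, key _ (Multiset.erase_le B β), Multiset.cons_erase hB]

/-- The first kind of successor changes the x-part, the second the number of blocks, and successors
of the third kind are told apart by the block containing a. -/
theorem nodup_step {a : α} {s : State α} (h1 : a ∉ s.1) (h2 : ∀ B ∈ s.2, a ∉ B)
    (hs : s.2.Nodup) : (step a s).Nodup := by
  obtain ⟨A, β⟩ := s
  have hA : a ::ₘ A ≠ A := fun h => h1 (h ▸ Multiset.mem_cons_self a A)
  have hf : ∀ B ∈ β, ((a ::ₘ B) ::ₘ β.erase B).filter (a ∈ ·) = {a ::ₘ B} := by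
    intro B hB
    rw [Multiset.filter_cons_of_pos (p := fun B : Multiset α => a ∈ B) _
        (Multiset.mem_cons_self a B),
      Multiset.filter_eq_nil.2 fun C hC => h2 C (Multiset.mem_of_mem_erase hC)]
    rfl
  rw [step, Multiset.nodup_cons, Multiset.nodup_cons]
  refine ⟨?_, ?_, ?_⟩
  · simp [hA, Ne.symm hA]
  · simp only [Multiset.mem_map, Prod.mk.injEq, true_and, not_exists, not_and]
    intro B hB h
    have := congrArg Multiset.card h
    rw [Multiset.card_cons, Multiset.card_cons, Multiset.card_erase_add_one hB] at this
    omega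
  · refine Multiset.Nodup.map_on (fun B hB C hC h => ?_) hs
    have h' := congrArg (Multiset.filter (a ∈ ·)) (Prod.mk.inj h).2
    rw [hf B hB, hf C hC] at h'
    simpa using h'

/-- The states whose labels are those of `m`, the labels in `u` not being used for derivatives with
respect to `x`. -/
def IsOn (u m : Multiset α) (s : State α) : Prop :=
  s.1 + s.2.join = m ∧ 0 ∉ s.2 ∧ ∀ x ∈ u, x ∉ s.1

theorem isOn_of_mem_step {u m : Multiset α} {a : α} {s t : State α} (hs : IsOn u m s)
    (ha : a ∉ u) (ht : t ∈ step a s) : IsOn u (a ::ₘ m) t := by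
  obtain ⟨A, β⟩ := s
  obtain ⟨hm, h0, hu⟩ := hs
  simp only at hm h0 hu
  rcases mem_step.1 ht with rfl | rfl | ⟨B, hB, rfl⟩
  · refine ⟨by simp [hm], h0, fun x hx h => ?_⟩
    rcases Multiset.mem_cons.1 h with rfl | h
    · exact ha hx
    · exact hu x hx h
  · exact ⟨by simp [← hm], by simpa [eq_comm] using h0, hu⟩
  · have hB' : B ∈ β := hB
    refine ⟨?_, ?_, hu⟩
    · rw [← hm]
      conv_rhs => rw [← Multiset.cons_erase hB']
      simp
    · simp only [Multiset.mem_cons, not_or]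
      exact ⟨(Multiset.cons_ne_zero).symm, fun h => h0 (Multiset.mem_of_mem_erase h)⟩

/-- The predecessor depends on whether a is an x-label, forms a block alone, or shares its block
with other labels. -/
theorem exists_mem_step_of_isOn {u m : Multiset α} {a : α} {t : State α}
    (ht : IsOn u (a ::ₘ m) t) : ∃ s, IsOn u m s ∧ t ∈ step a s := by
  obtain ⟨A, β⟩ := t
  obtain ⟨hm, h0, hu⟩ := ht
  simp only at hm h0 hu
  have ha : a ∈ A + β.join := hm ▸ Multiset.mem_cons_self a m
  rcases Multiset.mem_add.1 ha with h | h
  · obtain ⟨A, rfl⟩ := Multiset.exists_cons_of_mem h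
    refine ⟨(A, β), ⟨?_, h0, fun x hx h => hu x hx (Multiset.mem_cons_of_mem h)⟩,
      mem_step.2 (Or.inl rfl)⟩
    simpa using hm
  · obtain ⟨B, hB, haB⟩ := Multiset.mem_join.1 h
    obtain ⟨β, rfl⟩ := Multiset.exists_cons_of_mem hB
    obtain ⟨B, rfl⟩ := Multiset.exists_cons_of_mem haB
    simp only [Multiset.join_cons, Multiset.cons_add, Multiset.add_cons,
      Multiset.cons_inj_right] at hm
    simp only [Multiset.mem_cons, not_or] at h0
    rcases eq_or_ne B 0 with rfl | hB0
    · exact ⟨(A, β), ⟨by simpa using hm, h0.2, hu⟩, mem_step.2 (Or.inr (Or.inl rfl))⟩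
    · refine ⟨(A, B ::ₘ β), ⟨by simpa using hm, ?_, hu⟩,
        mem_step.2 (Or.inr (Or.inr ⟨B, by simp, by simp⟩))⟩
      simp only [Multiset.mem_cons, not_or]
      exact ⟨hB0.symm, h0.2⟩

variable {u : Multiset α} {β₀ : Multiset (Multiset α)}

/-- Both sides obey the same recursion in the last label; `hβ₀` says that they agree before any
label is added. -/
theorem mem_extensions_iff (hβ₀ : ∀ s, IsOn u u s ↔ s = (0, β₀)) {l : List α}
    (hl : (u + l).Nodup) {s : State α} :
    s ∈ extensions (0, β₀) l ↔ IsOn u (u + l) s := by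
  induction l generalizing s with
  | nil => simp [extensions, hβ₀]
  | cons a l ih =>
    rw [← Multiset.cons_coe, Multiset.add_cons, Multiset.nodup_cons] at hl
    rw [extensions, Multiset.mem_bind, ← Multiset.cons_coe, Multiset.add_cons]
    constructor
    · rintro ⟨t, ht, hs⟩
      exact isOn_of_mem_step ((ih hl.2).1 ht) (fun h => hl.1 (by simp [h])) hs
    · intro hs
      obtain ⟨t, ht, hst⟩ := exists_mem_step_of_isOn hs
      exact ⟨t, (ih hl.2).2 ht, hst⟩

theorem IsOn.nodup_snd {γ : Type*} {u m : Multiset γ} {s : State γ} (hs : IsOn u m s) (hm : m.Nodup) :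
    s.2.Nodup :=
  nodup_of_nodup_join ((Multiset.nodup_add.1 (hs.1 ▸ hm)).2.1) hs.2.1

/-- Different states have disjoint sets of successors, because `parent` recovers the state from any
successor. -/
theorem nodup_extensions (hβ₀ : ∀ s, IsOn u u s ↔ s = (0, β₀)) {l : List α}
    (hl : (u + l).Nodup) : (extensions (0, β₀) l).Nodup := by
  induction l with
  | nil => exact Multiset.nodup_singleton _
  | cons a l ih =>
    rw [← Multiset.cons_coe, Multiset.add_cons, Multiset.nodup_cons] at hl
    have hon : ∀ s ∈ extensions (0, β₀) l, IsOn u (u + l) s :=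
      fun s hs => (mem_extensions_iff hβ₀ hl.2).1 hs
    have h1 : ∀ s ∈ extensions (0, β₀) l, a ∉ s.1 := fun s hs h =>
      hl.1 ((hon s hs).1 ▸ Multiset.mem_add.2 (Or.inl h))
    have h2 : ∀ s ∈ extensions (0, β₀) l, ∀ B ∈ s.2, a ∉ B := fun s hs B hB h =>
      hl.1 ((hon s hs).1 ▸ Multiset.mem_add.2 (Or.inr (Multiset.mem_join.2 ⟨B, hB, h⟩)))
    rw [extensions, Multiset.nodup_bind]
    refine ⟨fun s hs => nodup_step (h1 s hs) (h2 s hs) ((hon s hs).nodup_snd hl.2), ?_⟩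
    refine Multiset.Nodup.pairwise (fun s hs t ht hst => ?_) (ih hl.2)
    refine Multiset.disjoint_left.2 fun {x} hxs hxt => hst ?_
    rw [← parent_of_mem_step (h1 s hs) (h2 s hs) (hon s hs).2.1 hxs,
      ← parent_of_mem_step (h1 t ht) (h2 t ht) (hon t ht).2.1 hxt]

end State

/-! ### The prolongation as a sum over states -/

section States

theorem isOn_zero_zero_iff {α : Type*} (s : State α) :
    State.IsOn 0 0 s ↔ s = ((0, 0) : State α) := by
  obtain ⟨A, β⟩ := s
  constructor
  · rintro ⟨h, h0, -⟩
    obtain ⟨h1, h2⟩ := add_eq_zero.1 h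
    simp only at h1 h2 h0
    refine Prod.ext h1 (Multiset.eq_zero_of_forall_notMem fun B hB => ?_)
    have hB0 : B = 0 := Multiset.eq_zero_of_forall_notMem fun x hx => by
      have := Multiset.mem_join.2 ⟨B, hB, hx⟩
      simp [h2] at this
    exact h0 (hB0 ▸ hB)
  · rintro h
    obtain ⟨rfl, rfl⟩ := Prod.mk.inj h
    simp [State.IsOn]

/-- The marked label may not lie in the x-part and blocks are nonempty, so it must form the only
block. -/
theorem isOn_singleton_singleton_iff {α : Type*} (a : α) (s : State α) :
    State.IsOn {a} {a} s ↔ s = ((0, {{a}}) : State α) := by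
  obtain ⟨A, β⟩ := s
  constructor
  · rintro ⟨h, h0, hu⟩
    simp only [Multiset.mem_singleton, forall_eq] at h h0 hu
    have ha : a ∈ A + β.join := h ▸ Multiset.mem_singleton_self a
    obtain ⟨B, hB, haB⟩ := Multiset.mem_join.1 ((Multiset.mem_add.1 ha).resolve_left hu)
    obtain ⟨β, rfl⟩ := Multiset.exists_cons_of_mem hB
    obtain ⟨B, rfl⟩ := Multiset.exists_cons_of_mem haB
    have h' : A + (B + β.join) = 0 := by
      simpa [← Multiset.cons_zero] using h
    obtain ⟨h1, h2⟩ := add_eq_zero.1 h'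
    obtain ⟨h2, h3⟩ := add_eq_zero.1 h2
    have hβ := (isOn_zero_zero_iff ((0, β) : State α)).1
      ⟨by simpa using h3, fun h => h0 (by simp [h]), by simp⟩
    rw [(Prod.mk.inj hβ).2, h1, h2]
    rfl
  · rintro h
    obtain ⟨rfl, rfl⟩ := Prod.mk.inj h
    refine ⟨by simp, ?_, by simp⟩
    simp

theorem coe_reverse_finRange (κ : ℕ) :
    ((List.finRange κ).reverse : Multiset (Fin κ)) = Finset.univ.val := by
  rw [Multiset.coe_reverse]
  rfl

theorem univ_val_option (κ : ℕ) :
    (Finset.univ : Finset (Option (Fin κ))).val =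
      none ::ₘ (Finset.univ : Finset (Fin κ)).val.map some := rfl

theorem singleton_add_coe_map_some (κ : ℕ) :
    ({none} + ((List.finRange κ).reverse.map some : List (Option (Fin κ))) :
      Multiset (Option (Fin κ))) = Finset.univ.val := by
  rw [univ_val_option, ← Multiset.map_coe, coe_reverse_finRange, Multiset.singleton_add]

/-- The states whose labels are `1, …, κ`. -/
def allStates (κ : ℕ) : Finset (State (Fin κ)) where
  val := State.extensions (0, 0) (List.finRange κ).reverse
  nodup := State.nodup_extensions isOn_zero_zero_iff (by simp [List.nodup_finRange])

/-- The states whose labels are `1, …, κ` and a marked label `none`, which belongs to a block. -/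
def markedStates (κ : ℕ) : Finset (State (Option (Fin κ))) where
  val := State.extensions (0, {{none}}) ((List.finRange κ).reverse.map some)
  nodup := State.nodup_extensions (isOn_singleton_singleton_iff none) (by
    rw [singleton_add_coe_map_some]
    exact Finset.nodup _)

theorem mem_allStates {κ : ℕ} {s : State (Fin κ)} :
    s ∈ allStates κ ↔ s.IsOn 0 Finset.univ.val := by
  have h := State.mem_extensions_iff (l := (List.finRange κ).reverse) isOn_zero_zero_iff
    (by simp [List.nodup_finRange]) (s := s)
  rw [coe_reverse_finRange, zero_add] at h
  exact h

theorem mem_markedStates {κ : ℕ} {s : State (Option (Fin κ))} :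
    s ∈ markedStates κ ↔ s.IsOn {none} Finset.univ.val := by
  have h := State.mem_extensions_iff (l := (List.finRange κ).reverse.map some)
    (isOn_singleton_singleton_iff none)
    (by
      rw [singleton_add_coe_map_some]
      exact Finset.nodup _) (s := s)
  rw [singleton_add_coe_map_some] at h
  exact h

variable {𝕜 : Type*} [RCLike 𝕜] {n : ℕ}

/-- The states are first taken on distinct labels, where they form a set, and are then renamed by i,
with `none` renamed to k. -/
theorem prolong_eq_sum_states {𝒳 : Fin n → Base 𝕜 n → 𝕜} {𝒴 : Base 𝕜 n → 𝕜}
    (h𝒳 : ∀ k, ContDiff 𝕜 ∞ (𝒳 k)) (h𝒴 : ContDiff 𝕜 ∞ 𝒴) (κ : ℕ) (i : Fin κ → Fin n)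
    (p : Jet 𝕜 n) :
    prolong 𝒳 𝒴 κ i p =
      ∑ s ∈ allStates κ, stateTerm 𝒴 0 (s.map i) p -
        ∑ s ∈ (markedStates κ).erase (0, {Finset.univ.val}),
          ∑ k, stateTerm (𝒳 k) 1 (s.map fun o => o.elim k i) p := by
  have hl : (List.ofFn i).reverse = (List.finRange κ).reverse.map i := by
    rw [List.ofFn_eq_map, List.map_reverse]
  rw [prolong_eq_sum_stateTerm h𝒳 h𝒴, Finset.sum_comm]
  congr 1
  · rw [hl]
    have := State.map_extensions i (0, 0) (List.finRange κ).reverse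
    rw [show State.map i (0, 0) = (0, 0) from rfl] at this
    rw [← this, Multiset.map_map]
    rfl
  · refine Finset.sum_congr rfl fun k _ => ?_
    have hl' : (List.ofFn i).reverse =
        ((List.finRange κ).reverse.map some).map fun o => o.elim k i := by
      rw [hl, List.map_map]
      rfl
    have hp : State.properExtensions none ((List.finRange κ).reverse.map some) =
        ((markedStates κ).erase (0, {Finset.univ.val})).val := by
      rw [Finset.erase_val, show (markedStates κ).val =
        State.extensions (0, {{none}}) ((List.finRange κ).reverse.map some) from rfl,
        ← State.properExtensions_add none,
        ← Multiset.singleton_add none, singleton_add_coe_map_some, Multiset.add_comm,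
        Multiset.singleton_add, Multiset.erase_cons_head]
    have := State.map_properExtensions (fun o : Option (Fin κ) => o.elim k i) none
      ((List.finRange κ).reverse.map some)
    simp only [Option.elim_none] at this
    rw [hl', ← this, hp, Multiset.map_map]
    rfl

end States

/-! ### Blocks of a labelling of the triples -/

section Blocks

variable {α β : Type*} {d : ℕ} {lam mu : Fin d → ℕ}

theorem tuple_eq_sum {l : ℕ} (k : Fin l → α) : tuple k = ∑ j, {k j} := by
  rw [tuple, ← Multiset.sum_map_singleton (Finset.univ.val.map k), Multiset.map_map]
  rfl

theorem card_tuple {l : ℕ} (k : Fin l → α) : (tuple k).card = l := by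
  simp [tuple]

theorem map_tuple (f : α → β) {l : ℕ} (k : Fin l → α) : (tuple k).map f = tuple (f ∘ k) := by
  rw [tuple, tuple, Multiset.map_map]

theorem mem_tuple {l : ℕ} {k : Fin l → α} {x : α} : x ∈ tuple k ↔ ∃ j, k j = x := by
  simp [tuple]

theorem exists_tuple_eq (s : Multiset α) {l : ℕ} (h : s.card = l) :
    ∃ k : Fin l → α, tuple k = s := by
  subst h
  induction s using Quotient.inductionOn with
  | h s => exact ⟨s.get, (Fin.univ_val_map s.get).trans (by rw [List.ofFn_get]; rfl)⟩

/-- The index multisets of the factors of the monomial of a labelling of the triples. -/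
def blocks (k : Pos d lam mu → α) : Multiset (Multiset α) :=
  (Finset.univ : Finset ((e : Fin d) × Fin (mu e))).val.map
    fun x => tuple fun j : Fin (lam x.1) => k ⟨x.1, x.2, j⟩

/-- The multiset of the sizes of the blocks. -/
def shape (lam mu : Fin d → ℕ) : Multiset ℕ :=
  (Finset.univ : Finset ((e : Fin d) × Fin (mu e))).val.map fun x => lam x.1

theorem jetMonomial_eq {R : Type*} [CommSemiring R] (y : Multiset α → R)
    (k : Pos d lam mu → α) : jetMonomial y k = ((blocks k).map y).prod := by
  rw [jetMonomial, blocks, Multiset.map_map]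
  exact (Fintype.prod_sigma fun x : (e : Fin d) × Fin (mu e) =>
    y (tuple fun j : Fin (lam x.1) => k ⟨x.1, x.2, j⟩)).symm

theorem map_blocks (f : α → β) (k : Pos d lam mu → α) :
    (blocks k).map (Multiset.map f) = blocks (f ∘ k) := by
  simp only [blocks, Multiset.map_map, Function.comp_def, map_tuple]

theorem map_card_blocks (k : Pos d lam mu → α) :
    (blocks k).map Multiset.card = shape lam mu := by
  simp only [blocks, shape, Multiset.map_map, Function.comp_def, card_tuple]

theorem join_blocks (k : Pos d lam mu → α) : (blocks k).join = Finset.univ.val.map k := by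
  have h1 : (blocks k).join = ∑ x : (e : Fin d) × Fin (mu e),
      ∑ j : Fin (lam x.1), ({k ⟨x.1, x.2, j⟩} : Multiset α) := by
    simp only [← tuple_eq_sum]
    rfl
  have h2 : Finset.univ.val.map k = ∑ a : Pos d lam mu, ({k a} : Multiset α) := by
    rw [← Multiset.sum_map_singleton (Finset.univ.val.map k), Multiset.map_map]
    rfl
  rw [h1, h2, Fintype.sum_sigma, Fintype.sum_sigma]
  exact Finset.sum_congr rfl fun e _ =>
    (Fintype.sum_prod_type fun x : Fin (mu e) × Fin (lam e) => ({k ⟨e, x⟩} : Multiset α)).symm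

/-- A formal monomial determines its multiset of variables. Membership in `stab` thereby becomes an
equality of families of blocks. -/
theorem prod_map_X_injective {R σ : Type*} [CommSemiring R] [Nontrivial R] :
    Function.Injective fun m : Multiset σ => (m.map (MvPolynomial.X (R := R))).prod := by
  classical
  have h : ∀ m : Multiset σ, (m.map (MvPolynomial.X (R := R))).prod =
      MvPolynomial.monomial (Multiset.toFinsupp m) 1 := by
    intro m
    induction m using Multiset.induction with
    | empty => simp
    | cons a m ih =>
      rw [Multiset.map_cons, Multiset.prod_cons, ih, ← Multiset.singleton_add, map_add,
        Multiset.toFinsupp_singleton, MvPolynomial.X, MvPolynomial.monomial_mul, one_mul]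
  intro m m' hm
  simp only [h] at hm
  exact Multiset.toFinsupp.injective (MvPolynomial.monomial_left_injective one_ne_zero hm)

theorem mem_stab_iff {σ : Equiv.Perm (Pos d lam mu)} :
    σ ∈ stab lam mu ↔ blocks (fun a => σ a) = blocks fun a : Pos d lam mu => a := by
  have h : σ ∈ stab lam mu ↔ jetMonomial (MvPolynomial.X (R := ℤ)) (fun a => σ a) =
    jetMonomial (MvPolynomial.X (R := ℤ)) (fun a : Pos d lam mu => a) := Iff.rfl
  rw [h, jetMonomial_eq, jetMonomial_eq]
  exact prod_map_X_injective.eq_iff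

theorem blocks_comp_of_mem_stab (k : Pos d lam mu → α) {σ : Equiv.Perm (Pos d lam mu)}
    (hσ : σ ∈ stab lam mu) : blocks (k ∘ σ) = blocks k := by
  have h := congrArg (Multiset.map (Multiset.map k)) (mem_stab_iff.1 hσ)
  rwa [map_blocks, map_blocks] at h

/-- An equality of multisets of values lifts to a matching. It is used to assign given blocks to
positions of the right sizes. -/
theorem exists_map_eq {ι X Y : Type*} [Nonempty X] (g : X → Y) (h : ι → Y) {s : Multiset ι}
    (hs : s.Nodup) {m : Multiset X} (hm : m.map g = s.map h) :
    ∃ f : ι → X, s.map f = m ∧ ∀ x ∈ s, g (f x) = h x := by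
  classical
  induction s using Multiset.induction generalizing m with
  | empty =>
    obtain rfl : m = 0 := by simpa using hm
    exact ⟨fun _ => Classical.arbitrary X, by simp, by simp⟩
  | cons x s ih =>
    obtain ⟨hx, hs⟩ := Multiset.nodup_cons.1 hs
    have : h x ∈ m.map g := by simp [hm]
    obtain ⟨b, hb, hgb⟩ := Multiset.mem_map.1 this
    obtain ⟨m, rfl⟩ := Multiset.exists_cons_of_mem hb
    rw [Multiset.map_cons, Multiset.map_cons, hgb, Multiset.cons_inj_right] at hm
    obtain ⟨f, hf, hfg⟩ := ih hs hm
    have hne : ∀ y ∈ s, y ≠ x := fun y hy h => hx (h ▸ hy)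
    refine ⟨Function.update f x b, ?_, ?_⟩
    · rw [Multiset.map_cons, Function.update_self, ← hf]
      congr 1
      exact Multiset.map_congr rfl fun y hy => Function.update_of_ne (hne y hy) _ _
    · intro y hy
      rcases Multiset.mem_cons.1 hy with rfl | hy
      · rw [Function.update_self, hgb]
      · rw [Function.update_of_ne (hne y hy), hfg y hy]

theorem exists_blocks_eq {γ : Multiset (Multiset α)} (h : γ.map Multiset.card = shape lam mu) :
    ∃ k : Pos d lam mu → α, blocks k = γ := by
  obtain ⟨f, hf, hfc⟩ := exists_map_eq Multiset.card _ (Finset.nodup _) h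
  choose t ht using fun x : (e : Fin d) × Fin (mu e) =>
    exists_tuple_eq (f x) (hfc x (Finset.mem_univ x))
  refine ⟨fun a => t ⟨a.1, a.2.1⟩ a.2.2, ?_⟩
  rw [← hf]
  exact Multiset.map_congr rfl fun x _ => ht x

theorem shape_eq_sum (lam mu : Fin d → ℕ) : shape lam mu = ∑ e, mu e • {lam e} := by
  have h : shape lam mu = ∑ x : (e : Fin d) × Fin (mu e), ({lam x.1} : Multiset ℕ) := by
    rw [shape, ← Multiset.sum_map_singleton (Multiset.map _ _), Multiset.map_map]
    rfl
  rw [h, Fintype.sum_sigma]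
  simp

theorem mem_shape {m : ℕ} (hmu : ∀ e, 1 ≤ mu e) : m ∈ shape lam mu ↔ ∃ e, lam e = m := by
  rw [shape, Multiset.mem_map]
  constructor
  · rintro ⟨x, -, h⟩
    exact ⟨x.1, h⟩
  · rintro ⟨e, h⟩
    exact ⟨⟨e, ⟨0, hmu e⟩⟩, Finset.mem_univ _, h⟩

theorem count_shape (hlam : Function.Injective lam) (e : Fin d) :
    (shape lam mu).count (lam e) = mu e := by
  rw [shape_eq_sum, Multiset.count_sum']
  simp [Multiset.count_singleton, hlam.eq_iff]

theorem sum_shape (lam mu : Fin d → ℕ) : (shape lam mu).sum = weight lam mu := by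
  rw [shape_eq_sum, weight, ← Multiset.coe_sumAddMonoidHom, map_sum]
  simp [Multiset.sum_nsmul]

theorem card_shape (lam mu : Fin d → ℕ) : (shape lam mu).card = ∑ e, mu e := by
  rw [shape, Multiset.card_map, Finset.card_val, Finset.card_univ, Fintype.card_sigma]
  simp

theorem exists_shape_eq (c : Multiset ℕ) :
    ∃ (d : ℕ) (lam mu : Fin d → ℕ), StrictMono lam ∧ (∀ e, 1 ≤ mu e) ∧ shape lam mu = c := by
  refine ⟨c.toFinset.card, c.toFinset.orderEmbOfFin rfl,
    fun e => c.count (c.toFinset.orderEmbOfFin rfl e), OrderEmbedding.strictMono _, fun e => ?_, ?_⟩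
  · exact Multiset.one_le_count_iff_mem.2
      (Multiset.mem_toFinset.1 (Finset.orderEmbOfFin_mem _ rfl e))
  · rw [shape_eq_sum]
    conv_rhs => rw [← Multiset.toFinset_sum_count_nsmul_eq c,
      ← Finset.map_orderEmbOfFin_univ c.toFinset rfl, Finset.sum_map]
    rfl

/-- The λ_e are the distinct sizes in increasing order and the μ_e their multiplicities; `1 ≤ mu e`
makes every λ_e occur. -/
theorem shape_injective {d' : ℕ} {lam' mu' : Fin d' → ℕ} (hl : StrictMono lam)
    (hm : ∀ e, 1 ≤ mu e) (hl' : StrictMono lam') (hm' : ∀ e, 1 ≤ mu' e)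
    (h : shape lam mu = shape lam' mu') :
    (⟨d, lam, mu⟩ : (d : ℕ) × (_ : Fin d → ℕ) × (Fin d → ℕ)) = ⟨d', lam', mu'⟩ := by
  have hr : Set.range lam = Set.range lam' := by
    ext m
    rw [Set.mem_range, Set.mem_range, ← mem_shape hm, ← mem_shape hm', h]
  obtain rfl : d = d' := by
    have := congrArg Set.ncard hr
    rwa [Set.ncard_range_of_injective hl.injective, Set.ncard_range_of_injective hl'.injective,
      Nat.card_fin, Nat.card_fin] at this
  obtain rfl := (hl.range_inj hl').1 hr
  obtain rfl : mu = mu' := by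
    funext e
    rw [← count_shape (mu := mu) hl.injective, ← count_shape (mu := mu') hl.injective, h]
  rfl

end Blocks

/-! ### Cosets of the stabilizer and distributions of labels into blocks -/

section Representatives

variable {α : Type*} {d : ℕ} {lam mu : Fin d → ℕ}

theorem injective_of_nodup_map {ι : Type*} [Fintype ι] {f : ι → α}
    (h : (Finset.univ.val.map f).Nodup) : Function.Injective f := fun a b hab =>
  Multiset.inj_on_of_nodup_map h a (Finset.mem_univ a) b (Finset.mem_univ b) hab

theorem map_posEquiv (w : Fin (weight lam mu) → α) :
    Finset.univ.val.map (w ∘ posEquiv lam mu) = tuple w := by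
  rw [← Multiset.map_map, tuple]
  congr 1
  exact congrArg Finset.val (Finset.map_univ_equiv (posEquiv lam mu))

theorem exists_perm_comp_eq {ι : Type*} [Fintype ι] {e v : ι → α} (he : Function.Injective e)
    (h : Finset.univ.val.map e = Finset.univ.val.map v) :
    ∃ ρ : Equiv.Perm ι, v ∘ ρ = e := by
  have hex : ∀ a, ∃ b, v b = e a := fun a => by
    have : e a ∈ Finset.univ.val.map e := Multiset.mem_map_of_mem e (Finset.mem_univ a)
    rw [h] at this
    obtain ⟨b, -, hb⟩ := Multiset.mem_map.1 this
    exact ⟨b, hb⟩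
  choose r hr using hex
  have hinj : Function.Injective r := fun a b hab => he (by rw [← hr, ← hr, hab])
  exact ⟨Equiv.ofBijective r (Finite.injective_iff_bijective.1 hinj), funext hr⟩

/-- For distinct letters, equal blocks force σ σ'⁻¹ to preserve the general monomial, so σ and σ'
represent the same coset. -/
theorem eq_of_blocks_eq {F : Finset (Equiv.Perm (Pos d lam mu))}
    (hF : Subgroup.IsComplement (stab lam mu : Set (Equiv.Perm (Pos d lam mu)))
      (F : Set (Equiv.Perm (Pos d lam mu))))
    {v : Pos d lam mu → α} (hv : Function.Injective v) {σ σ' : Equiv.Perm (Pos d lam mu)}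
    (hσ : σ ∈ F) (hσ' : σ' ∈ F) (h : blocks (v ∘ σ.symm) = blocks (v ∘ σ'.symm)) : σ = σ' := by
  rw [← map_blocks, ← map_blocks] at h
  have h1 := congrArg (Multiset.map (Multiset.map σ))
    (Multiset.map_injective (Multiset.map_injective hv) h)
  rw [map_blocks, map_blocks] at h1
  have hmem : σ * σ'⁻¹ ∈ stab lam mu := by
    rw [mem_stab_iff]
    refine Eq.trans ?_ (h1.symm.trans ?_)
    · rfl
    · congr 1
      funext a
      simp
  -- The element σ has the two factorizations (σ σ'⁻¹) · σ' and 1 · σ, and factorizations are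
  -- unique.
  have := hF.1 (a₁ := (⟨σ * σ'⁻¹, hmem⟩, ⟨σ', hσ'⟩)) (a₂ := (⟨1, one_mem _⟩, ⟨σ, hσ⟩)) (by simp)
  exact (congrArg Subtype.val (Prod.mk.inj this).2).symm

/-- Write ρ⁻¹ = h σ with h in the stabilizer and σ in F. Then ρ = σ⁻¹ h⁻¹, and the factor h⁻¹ does
not affect the blocks. -/
theorem exists_blocks_comp_eq {F : Finset (Equiv.Perm (Pos d lam mu))}
    (hF : Subgroup.IsComplement (stab lam mu : Set (Equiv.Perm (Pos d lam mu)))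
      (F : Set (Equiv.Perm (Pos d lam mu))))
    (v : Pos d lam mu → α) (ρ : Equiv.Perm (Pos d lam mu)) :
    ∃ σ ∈ F, blocks (v ∘ σ.symm) = blocks (v ∘ ρ) := by
  obtain ⟨⟨⟨h, hh⟩, ⟨σ, hσ⟩⟩, hρ⟩ := hF.2 ρ⁻¹
  refine ⟨σ, hσ, ?_⟩
  have hρ' : ρ = σ⁻¹ * h⁻¹ := by
    rw [← mul_inv_rev]
    exact (inv_eq_iff_eq_inv.2 hρ).symm
  rw [hρ']
  exact (blocks_comp_of_mem_stab (v ∘ σ.symm) ((stab lam mu).inv_mem hh)).symm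

/-- The sum over the states of a given shape, computed with representatives `σ` of the cosets of
`stab` and words `w t` in the labels which are not used for derivatives with respect to `x`. -/
theorem sum_representatives {F : Finset (Equiv.Perm (Pos d lam mu))}
    (hF : Subgroup.IsComplement (stab lam mu : Set (Equiv.Perm (Pos d lam mu)))
      (F : Set (Equiv.Perm (Pos d lam mu))))
    (hlam : ∀ e, 1 ≤ lam e) {ι R : Type*} [AddCommMonoid R] {Q : Finset ι}
    {w : ι → Fin (weight lam mu) → α} {A : ι → Multiset α} {P : Finset (State α)}
    {u m : Multiset α} (hm : m.Nodup) (hP : ∀ s, s ∈ P ↔ s.IsOn u m)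
    (hA : ∀ t ∈ Q, A t + tuple (w t) = m) (hu : ∀ t ∈ Q, ∀ x ∈ u, x ∉ A t)
    (hinj : ∀ t ∈ Q, ∀ t' ∈ Q, A t = A t' → t = t')
    (hsurj : ∀ A' γ, A' + γ = m → γ.card = weight lam mu → (∀ x ∈ u, x ∉ A') →
      ∃ t ∈ Q, A t = A') (G : State α → R) :
    ∑ σ ∈ F, ∑ t ∈ Q, G (A t, blocks (w t ∘ posEquiv lam mu ∘ σ.symm)) =
      ∑ s ∈ P with s.2.map Multiset.card = shape lam mu, G s := by
  have hnodup : ∀ t ∈ Q, (Finset.univ.val.map (w t ∘ posEquiv lam mu)).Nodup := fun t ht => by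
    rw [map_posEquiv]
    exact (Multiset.nodup_add.1 ((hA t ht).symm ▸ hm)).2.1
  -- The pairs (σ, t) correspond bijectively to the states of this shape: t gives the x-part and σ
  -- the blocks.
  rw [← Finset.sum_product']
  refine Finset.sum_bij
    (fun x _ => (A x.2, blocks (w x.2 ∘ posEquiv lam mu ∘ x.1.symm))) ?_ ?_ ?_ fun _ _ => rfl
  · rintro ⟨σ, t⟩ hx
    obtain ⟨-, ht⟩ := Finset.mem_product.1 hx
    refine Finset.mem_filter.2 ⟨(hP _).2 ⟨?_, ?_, hu t ht⟩, map_card_blocks _⟩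
    · rw [← hA t ht, ← map_posEquiv, join_blocks, ← Function.comp_assoc, ← Multiset.map_map]
      congr 2
      exact congrArg Finset.val (Finset.map_univ_equiv σ.symm)
    · intro h
      have := Multiset.mem_map_of_mem Multiset.card h
      rw [map_card_blocks, shape, Multiset.mem_map] at this
      obtain ⟨x, -, hx⟩ := this
      have := hlam x.1
      simp only [Multiset.card_zero] at hx
      omega
  · rintro ⟨σ, t⟩ hx ⟨σ', t'⟩ hx' h
    obtain ⟨hσ, ht⟩ := Finset.mem_product.1 hx
    obtain ⟨hσ', ht'⟩ := Finset.mem_product.1 hx'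
    obtain ⟨h1, h2⟩ := Prod.mk.inj h
    obtain rfl : t = t' := hinj t ht t' ht' h1
    obtain rfl : σ = σ' := eq_of_blocks_eq hF (injective_of_nodup_map (hnodup t ht)) hσ hσ' h2
    rfl
  · rintro ⟨A', β⟩ hs
    obtain ⟨hs, hshape⟩ := Finset.mem_filter.1 hs
    obtain ⟨hm', -, hu'⟩ := (hP _).1 hs
    obtain ⟨t, ht, rfl⟩ := hsurj A' β.join hm'
      (by rw [Multiset.card_join, ← sum_shape, ← hshape]) hu'
    -- Surjectivity: list the given blocks along the triples. This labelling is a rearrangement ρ of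
    -- the word of t, and ρ may be replaced by the inverse of a representative.
    obtain ⟨e, rfl⟩ := exists_blocks_eq hshape
    have he : Finset.univ.val.map e = Finset.univ.val.map (w t ∘ posEquiv lam mu) := by
      rw [map_posEquiv, ← join_blocks]
      exact add_left_cancel (hm'.trans (hA t ht).symm)
    obtain ⟨ρ, hρ⟩ := exists_perm_comp_eq (injective_of_nodup_map (he ▸ hnodup t ht)) he
    obtain ⟨σ, hσ, hσb⟩ := exists_blocks_comp_eq hF (w t ∘ posEquiv lam mu) ρ
    exact ⟨(σ, t), Finset.mem_product.2 ⟨hσ, ht⟩, Prod.ext rfl (hσb.trans (by rw [hρ]))⟩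

end Representatives

/-! ### Summation over all shapes -/

section Shapes

theorem mem_lambdas {κ d : ℕ} {lam : Fin d → ℕ} :
    lam ∈ lambdas κ d ↔ (∀ e, 1 ≤ lam e ∧ lam e ≤ κ) ∧ StrictMono lam := by
  simp [lambdas, Fintype.mem_piFinset]

theorem mem_mus {κ d : ℕ} {lam mu : Fin d → ℕ} :
    mu ∈ mus κ lam ↔ (∀ e, 1 ≤ mu e ∧ mu e ≤ κ + 1) ∧ weight lam mu ≤ κ + 1 := by
  simp [mus, Fintype.mem_piFinset]

theorem sum_lambdas_mus {R : Type*} [AddCommMonoid R] (κ : ℕ)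
    (H : (d : ℕ) → (Fin d → ℕ) → (Fin d → ℕ) → R) :
    ∑ d ∈ Finset.Icc 1 (κ + 1), ∑ lam ∈ lambdas κ d, ∑ mu ∈ mus κ lam, H d lam mu =
      ∑ x ∈ (Finset.Icc 1 (κ + 1)).sigma fun d => (lambdas κ d).sigma fun lam => mus κ lam,
        H x.1 x.2.1 x.2.2 := by
  rw [Finset.sum_sigma]
  refine Finset.sum_congr rfl fun d _ => ?_
  rw [Finset.sum_sigma]

/-- Each state has exactly one shape, and the hypotheses on P place that shape within the ranges of
d, λ and μ in the formula. -/
theorem sum_shapes {α R : Type*} [AddCommMonoid R] {κ : ℕ} {P : Finset (State α)}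
    (h0 : ∀ s ∈ P, 0 ∉ s.2) (hne : ∀ s ∈ P, s.2 ≠ 0)
    (hcard : ∀ s ∈ P, ∀ B ∈ s.2, B.card ≤ κ) (hjoin : ∀ s ∈ P, s.2.join.card ≤ κ + 1)
    (G : State α → R) :
    ∑ d ∈ Finset.Icc 1 (κ + 1), ∑ lam ∈ lambdas κ d, ∑ mu ∈ mus κ lam,
        ∑ s ∈ P with s.2.map Multiset.card = shape lam mu, G s = ∑ s ∈ P, G s := by
  rw [sum_lambdas_mus κ fun d lam mu =>
    ∑ s ∈ P with s.2.map Multiset.card = shape lam mu, G s]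
  simp only [Finset.sum_filter]
  rw [Finset.sum_comm]
  refine Finset.sum_congr rfl fun s hs => ?_
  obtain ⟨d, lam, mu, hlam, hmu, hshape⟩ := exists_shape_eq (s.2.map Multiset.card)
  have hmem : ∀ e, ∃ B ∈ s.2, B.card = lam e := fun e => by
    have : lam e ∈ s.2.map Multiset.card := hshape ▸ (mem_shape hmu).2 ⟨e, rfl⟩
    exact Multiset.mem_map.1 this
  have hlam1 : ∀ e, 1 ≤ lam e := fun e => by
    obtain ⟨B, hB, hBe⟩ := hmem e
    rw [← hBe, Nat.one_le_iff_ne_zero, ne_eq, Multiset.card_eq_zero]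
    rintro rfl
    exact h0 s hs hB
  have hweight : weight lam mu ≤ κ + 1 := by
    rw [← sum_shape, hshape, ← Multiset.card_join]
    exact hjoin s hs
  have hle : ∀ e, mu e ≤ mu e * lam e := fun e => Nat.le_mul_of_pos_right _ (hlam1 e)
  have hd0 : d ≠ 0 := by
    rintro rfl
    refine hne s hs (Multiset.map_eq_zero.1 (hshape.symm.trans ?_))
    simp [shape_eq_sum]
  have hd : d ≤ κ + 1 := calc
    d = ∑ _e : Fin d, 1 := by simp
    _ ≤ ∑ e, mu e * lam e := Finset.sum_le_sum fun e _ => (hmu e).trans (hle e)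
    _ ≤ κ + 1 := hweight
  have hx : (⟨d, lam, mu⟩ : (d : ℕ) × (_ : Fin d → ℕ) × (Fin d → ℕ)) ∈
      (Finset.Icc 1 (κ + 1)).sigma fun d => (lambdas κ d).sigma fun lam => mus κ lam := by
    refine Finset.mem_sigma.2 ⟨Finset.mem_Icc.2 ⟨Nat.one_le_iff_ne_zero.2 hd0, hd⟩,
      Finset.mem_sigma.2 ⟨mem_lambdas.2 ⟨fun e => ⟨hlam1 e, ?_⟩, hlam⟩,
        mem_mus.2 ⟨fun e => ⟨hmu e, ?_⟩, hweight⟩⟩⟩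
    · obtain ⟨B, hB, hBe⟩ := hmem e
      exact hBe.symm.le.trans (hcard s hs B hB)
    · exact ((hle e).trans (Finset.single_le_sum (f := fun e => mu e * lam e)
        (fun _ _ => Nat.zero_le _) (Finset.mem_univ e))).trans hweight
  rw [Finset.sum_eq_single_of_mem _ hx, if_pos hshape.symm]
  rintro ⟨d', lam', mu'⟩ hx' hne'
  refine if_neg fun h => hne' ?_
  obtain ⟨-, hx'⟩ := Finset.mem_sigma.1 hx'
  obtain ⟨hl', hm'⟩ := Finset.mem_sigma.1 hx'
  exact shape_injective (mem_lambdas.1 hl').2 (fun e => ((mem_mus.1 hm').1 e).1) hlam hmu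
    (h.symm.trans hshape.symm)

end Shapes

/-! ### Shuffles -/

section Shuffles

variable {α : Type*}

theorem tuple_add_tuple {p q r : ℕ} (h : p = q + r) (f : Fin p → α) :
    (tuple fun a : Fin q => f ⟨a, by omega⟩) + (tuple fun a : Fin r => f ⟨q + a, by omega⟩) =
      tuple f := by
  subst h
  simp only [tuple_eq_sum]
  rw [Fin.sum_univ_add]
  rfl

theorem firstPart_add_lastPart {p q : ℕ} (h : q ≤ p) (f : Fin p → α) :
    tuple (firstPart q h f) + tuple (lastPart q f) = tuple f :=
  tuple_add_tuple (by omega) f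

theorem tuple_perm {κ : ℕ} (τ : Equiv.Perm (Fin κ)) : tuple τ = Finset.univ.val :=
  congrArg Finset.val (Finset.map_univ_equiv τ)

theorem strictMono_firstPart {κ q : ℕ} (h : q ≤ κ) {τ : Equiv.Perm (Fin κ)}
    (hτ : τ ∈ shuffles κ q) : StrictMono (firstPart q h τ) := fun a b hab =>
  (Finset.mem_filter.1 hτ).2.2.1 _ _ (by exact hab) b.2

theorem strictMono_lastPart {κ q : ℕ} {τ : Equiv.Perm (Fin κ)}
    (hτ : τ ∈ shuffles κ q) : StrictMono (lastPart q τ) := fun _ _ hab =>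
  (Finset.mem_filter.1 hτ).2.2.2 _ _ (Nat.le_add_right _ _)
    (Nat.add_lt_add_left hab q)

theorem eq_of_tuple_eq {κ r : ℕ} {f g : Fin r → Fin κ} (hf : StrictMono f) (hg : StrictMono g)
    (h : tuple f = tuple g) : f = g := by
  refine (hf.range_inj hg).1 ?_
  ext x
  rw [Set.mem_range, Set.mem_range, ← mem_tuple, ← mem_tuple, h]

/-- The set of values on the last part determines that on the first part, and on each part the
values are increasing. -/
theorem shuffle_ext {κ q : ℕ} (h : q ≤ κ) {τ τ' : Equiv.Perm (Fin κ)} (hτ : τ ∈ shuffles κ q)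
    (hτ' : τ' ∈ shuffles κ q) (he : tuple (lastPart q τ) = tuple (lastPart q τ')) : τ = τ' := by
  have h1 := firstPart_add_lastPart h τ
  rw [tuple_perm, ← tuple_perm τ', ← firstPart_add_lastPart h τ', he] at h1
  have hfirst := eq_of_tuple_eq (strictMono_firstPart h hτ) (strictMono_firstPart h hτ')
    (add_right_cancel h1)
  have hlast := eq_of_tuple_eq (strictMono_lastPart hτ) (strictMono_lastPart hτ') he
  ext1 a
  by_cases ha : (a : ℕ) < q
  · exact congrFun hfirst ⟨a, ha⟩
  · have := congrFun hlast ⟨a - q, by omega⟩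
    have e : (⟨q + (a - q), by omega⟩ : Fin κ) = a := Fin.ext (by simp; omega)
    simpa only [lastPart, e] using this

theorem exists_shuffle {κ q : ℕ} {A γ : Multiset (Fin κ)} (h : A + γ = Finset.univ.val)
    (hγ : γ.card = q) : ∃ τ ∈ shuffles κ q, tuple (lastPart q τ) = A := by
  have hcard : A.card + q = κ := by
    have := congrArg Multiset.card h
    simpa [hγ] using this
  have hn : (A + γ).Nodup := h ▸ Finset.nodup _
  obtain ⟨hA, hγn, hd⟩ := Multiset.nodup_add.1 hn
  let fA := Finset.orderEmbOfFin (⟨A, hA⟩ : Finset (Fin κ)) (k := κ - q)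
    (by rw [Finset.card_mk]; omega)
  let fγ := Finset.orderEmbOfFin (⟨γ, hγn⟩ : Finset (Fin κ)) (k := q) hγ
  have hfA : ∀ a, fA a ∈ A := fun a => Finset.orderEmbOfFin_mem _ _ a
  have hfγ : ∀ a, fγ a ∈ γ := fun a => Finset.orderEmbOfFin_mem _ _ a
  let f : Fin κ → Fin κ := fun a =>
    if ha : (a : ℕ) < q then fγ ⟨a, ha⟩ else fA ⟨a - q, by omega⟩
  have hf : Function.Injective f := by
    intro a b hab
    simp only [f] at hab
    split_ifs at hab with ha hb hb
    · simpa [Fin.ext_iff] using fγ.injective hab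
    · exact absurd (hfγ _) (Multiset.disjoint_left.1 hd (hab ▸ hfA _))
    · exact absurd (hfγ _) (Multiset.disjoint_left.1 hd (hab ▸ hfA _))
    · have := Fin.ext_iff.1 (fA.injective hab)
      simp only at this
      omega
  have hlast : lastPart q f = fA := by
    funext a
    simp [lastPart, f]
  refine ⟨Equiv.ofBijective f (Finite.injective_iff_bijective.1 hf),
    Finset.mem_filter.2 ⟨Finset.mem_univ _, by omega, fun a b hab hb => ?_, fun a b ha hab => ?_⟩,
    ?_⟩
  · have ha : (a : ℕ) < q := lt_trans (by exact hab) hb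
    simp only [Equiv.ofBijective_apply, f, dif_pos ha, dif_pos hb]
    exact fγ.strictMono hab
  · have hb : q ≤ (b : ℕ) := ha.trans (le_of_lt hab)
    simp only [Equiv.ofBijective_apply, f, dif_neg ha.not_gt, dif_neg hb.not_gt]
    refine fA.strictMono ?_
    rw [Fin.lt_def] at hab ⊢
    simp only
    omega
  · refine Eq.trans (congrArg tuple hlast) ?_
    exact congrArg Finset.val (Finset.map_orderEmbOfFin_univ (⟨A, hA⟩ : Finset (Fin κ))
      (by rw [Finset.card_mk]; omega))

end Shuffles

/-! ### The order of the stabilizer -/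

section Stabilizer

variable {d : ℕ} {lam mu : Fin d → ℕ}

/-- The permutation of the triples which permutes the blocks of each size and the elements of each
block. -/
def blockPerm (lam mu : Fin d → ℕ)
    (x : ∀ e, Equiv.Perm (Fin (mu e)) × (Fin (mu e) → Equiv.Perm (Fin (lam e)))) :
    Equiv.Perm (Pos d lam mu) :=
  Equiv.sigmaCongrRight fun e => (x e).1.prodShear (x e).2

theorem blockPerm_apply
    (x : ∀ e, Equiv.Perm (Fin (mu e)) × (Fin (mu e) → Equiv.Perm (Fin (lam e)))) (e : Fin d)
    (ν : Fin (mu e)) (j : Fin (lam e)) :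
    blockPerm lam mu x ⟨e, ν, j⟩ = ⟨e, (x e).1 ν, (x e).2 ν j⟩ := rfl

/-- Blocks are nonempty, so the permutation of the blocks can be read off from their elements. -/
theorem blockPerm_injective (hlam : ∀ e, 1 ≤ lam e) :
    Function.Injective (blockPerm lam mu) := by
  intro x y h
  have key : ∀ e ν j, (x e).1 ν = (y e).1 ν ∧ (x e).2 ν j = (y e).2 ν j := fun e ν j => by
    have := Equiv.congr_fun h ⟨e, ν, j⟩
    simpa [blockPerm_apply] using this
  funext e
  refine Prod.ext (Equiv.ext fun ν => (key e ν ⟨0, hlam e⟩).1) ?_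
  funext ν
  exact Equiv.ext fun j => (key e ν j).2

theorem blockPerm_mem_stab
    (x : ∀ e, Equiv.Perm (Fin (mu e)) × (Fin (mu e) → Equiv.Perm (Fin (lam e)))) :
    blockPerm lam mu x ∈ stab lam mu := by
  rw [mem_stab_iff]
  have h : ∀ y : (e : Fin d) × Fin (mu e),
      (tuple fun j : Fin (lam y.1) => blockPerm lam mu x ⟨y.1, y.2, j⟩) =
        tuple fun j : Fin (lam y.1) => (⟨y.1, (x y.1).1 y.2, j⟩ : Pos d lam mu) := by
    intro y
    simp only [blockPerm_apply, tuple_eq_sum]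
    exact Equiv.sum_comp ((x y.1).2 y.2) fun j =>
      ({(⟨y.1, (x y.1).1 y.2, j⟩ : Pos d lam mu)} : Multiset (Pos d lam mu))
  let π : Equiv.Perm ((e : Fin d) × Fin (mu e)) := Equiv.sigmaCongrRight fun e => (x e).1
  have hπ : (Finset.univ : Finset ((e : Fin d) × Fin (mu e))).val.map π = Finset.univ.val :=
    congrArg Finset.val (Finset.map_univ_equiv π)
  unfold blocks
  simp only [h]
  conv_rhs => rw [← hπ, Multiset.map_map]
  rfl

/-- A stabilizing permutation carries blocks to blocks of the same size; since the λ_e are distinct,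
it preserves e. -/
theorem exists_blockPerm_eq (hl : StrictMono lam) (hlam : ∀ e, 1 ≤ lam e)
    {σ : Equiv.Perm (Pos d lam mu)} (hσ : σ ∈ stab lam mu) : ∃ x, blockPerm lam mu x = σ := by
  have hblock : ∀ e (ν : Fin (mu e)), ∃ ν' : Fin (mu e), ∀ j : Fin (lam e),
      ∃ j' : Fin (lam e), (⟨e, ν', j'⟩ : Pos d lam mu) = σ ⟨e, ν, j⟩ := by
    intro e ν
    have h1 : (tuple fun j : Fin (lam e) => σ ⟨e, ν, j⟩) ∈ blocks fun a => σ a :=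
      Multiset.mem_map.2 ⟨⟨e, ν⟩, Finset.mem_univ _, rfl⟩
    rw [mem_stab_iff.1 hσ] at h1
    obtain ⟨⟨e', ν'⟩, -, h2⟩ := Multiset.mem_map.1 h1
    have hc := congrArg Multiset.card h2
    rw [card_tuple, card_tuple] at hc
    obtain rfl : e' = e := hl.injective hc
    refine ⟨ν', fun j => ?_⟩
    have hj : σ ⟨e', ν, j⟩ ∈ tuple fun j : Fin (lam e') => σ ⟨e', ν, j⟩ := mem_tuple.2 ⟨j, rfl⟩
    rw [← h2] at hj
    exact mem_tuple.1 hj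
  choose π ρ hρ using hblock
  have hρi : ∀ e ν, Function.Injective (ρ e ν) := by
    intro e ν j j' h
    have : σ ⟨e, ν, j⟩ = σ ⟨e, ν, j'⟩ := by rw [← hρ, ← hρ, h]
    simpa using σ.injective this
  have hρb : ∀ e ν, Function.Bijective (ρ e ν) := fun e ν =>
    Finite.injective_iff_bijective.1 (hρi e ν)
  have hπi : ∀ e, Function.Injective (π e) := by
    intro e ν ν' h
    obtain ⟨j', hj'⟩ := (hρb e ν').2 (ρ e ν ⟨0, hlam e⟩)
    have h1 := hρ e ν' j'
    rw [hj', ← h, hρ e ν] at h1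
    have := σ.injective h1
    simp only [Sigma.mk.injEq, heq_eq_eq, Prod.mk.injEq, true_and] at this
    exact this.1
  refine ⟨fun e => (Equiv.ofBijective (π e) (Finite.injective_iff_bijective.1 (hπi e)),
    fun ν => Equiv.ofBijective (ρ e ν) (hρb e ν)), Equiv.ext ?_⟩
  rintro ⟨e, ν, j⟩
  exact hρ e ν j

theorem card_stab (hl : StrictMono lam) (hlam : ∀ e, 1 ≤ lam e) :
    Nat.card (stab lam mu) = ∏ e, (mu e)! * ((lam e)!) ^ mu e := by
  have hb : Function.Bijective fun x => (⟨blockPerm lam mu x, blockPerm_mem_stab x⟩ :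
      stab lam mu) := by
    refine ⟨fun x y h => blockPerm_injective hlam (congrArg Subtype.val h), ?_⟩
    rintro ⟨σ, hσ⟩
    obtain ⟨x, rfl⟩ := exists_blockPerm_eq hl hlam hσ
    exact ⟨x, rfl⟩
  rw [← Nat.card_congr (Equiv.ofBijective _ hb), Nat.card_eq_fintype_card, Fintype.card_pi]
  simp [Fintype.card_perm]

end Stabilizer

/-! ### The explicit formula as a sum over states -/

section Collapse

variable {n : ℕ} {d : ℕ} {lam mu : Fin d → ℕ} {R : Type*} [CommSemiring R]

theorem kron_eq_ite {r : ℕ} (i k : Fin r → Fin n) :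
    kron i k R = if k = i then 1 else 0 := by
  rw [kron]
  split_ifs with h
  · subst h
    simp
  · obtain ⟨a, ha⟩ := Function.ne_iff.1 h
    exact Finset.prod_eq_zero (Finset.mem_univ a) (if_neg fun h => ha h.symm)

/-- The words in the numbering of the triples, as labellings of the triples. -/
def permutedEquiv (σ : Equiv.Perm (Pos d lam mu)) :
    (Fin (weight lam mu) → Fin n) ≃ (Pos d lam mu → Fin n) :=
  Equiv.arrowCongr (((posEquiv lam mu).symm.trans σ)) (Equiv.refl _)

theorem permutedEquiv_apply (σ : Equiv.Perm (Pos d lam mu)) (v : Fin (weight lam mu) → Fin n) :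
    permutedEquiv σ v = v ∘ posEquiv lam mu ∘ σ.symm := rfl

theorem permuted_permutedEquiv (σ : Equiv.Perm (Pos d lam mu))
    (v : Fin (weight lam mu) → Fin n) : permuted (permutedEquiv σ v) σ = v := by
  funext a
  simp [permuted, permutedEquiv_apply]

/-- Only the k that reads u along the order of the triples permuted by σ survives. -/
theorem sum_kron_mul (u : Fin (weight lam mu) → Fin n) (σ : Equiv.Perm (Pos d lam mu))
    (H : (Pos d lam mu → Fin n) → R) :
    ∑ k, kron u (permuted k σ) R * H k = H (u ∘ posEquiv lam mu ∘ σ.symm) := by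
  rw [← (permutedEquiv σ).sum_comp]
  simp only [permuted_permutedEquiv, kron_eq_ite, ite_mul, one_mul, zero_mul]
  rw [Finset.sum_ite_eq' Finset.univ u, if_pos (Finset.mem_univ u)]
  rfl

/-- The word which starts with `u` and whose other letters are `x`. -/
def extendWord {α : Type*} {N q : ℕ} (u : Fin q → α) (x : α) : Fin N → α :=
  fun a => if h : (a : ℕ) < q then u ⟨a, h⟩ else x

/-- The symbols fix all letters but the last, which remains as the summation variable x. -/
theorem sum_kron_firstPart_mul {N q : ℕ} (hq : N = q + 1) (h : q ≤ N) (u : Fin q → Fin n)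
    (H : (Fin N → Fin n) → R) :
    ∑ v, kron u (firstPart q h v) R * H v = ∑ x, H (extendWord u x) := by
  simp only [kron_eq_ite, ite_mul, one_mul, zero_mul]
  rw [← Finset.sum_filter]
  have key : ∀ v : Fin N → Fin n, firstPart q h v = u → extendWord u (v ⟨q, by omega⟩) = v := by
    rintro v rfl
    funext a
    by_cases ha : (a : ℕ) < q
    · simp [extendWord, ha, firstPart]
    · rw [show a = ⟨q, by omega⟩ from Fin.ext (by simp; omega)]
      simp [extendWord]
  refine Finset.sum_bij' (fun v _ => v ⟨q, by omega⟩) (fun x _ => extendWord u x)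
    (fun _ _ => Finset.mem_univ _) (fun x _ => Finset.mem_filter.2 ⟨Finset.mem_univ _, ?_⟩)
    (fun v hv => key v (Finset.mem_filter.1 hv).2) (fun x _ => ?_)
    fun v hv => by rw [key v (Finset.mem_filter.1 hv).2]
  · funext a
    simp [firstPart, extendWord]
  · simp [extendWord]

end Collapse

/-! ### Shuffles and representatives enumerate the states of a given shape -/

section Words

variable {κ : ℕ} {d : ℕ} {lam mu : Fin d → ℕ}

theorem sum_words_all {F : Finset (Equiv.Perm (Pos d lam mu))}
    (hF : Subgroup.IsComplement (stab lam mu : Set (Equiv.Perm (Pos d lam mu)))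
      (F : Set (Equiv.Perm (Pos d lam mu))))
    (hlam : ∀ e, 1 ≤ lam e) {R : Type*} [AddCommMonoid R] (h : weight lam mu ≤ κ)
    (G : State (Fin κ) → R) :
    ∑ σ ∈ F, ∑ τ ∈ shuffles κ (weight lam mu),
        G (tuple (lastPart (weight lam mu) τ),
          blocks (firstPart (weight lam mu) h τ ∘ posEquiv lam mu ∘ σ.symm)) =
      ∑ s ∈ allStates κ with s.2.map Multiset.card = shape lam mu, G s := by
  refine sum_representatives hF hlam
    (A := fun τ : Equiv.Perm (Fin κ) => tuple (lastPart (weight lam mu) τ))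
    (w := fun τ : Equiv.Perm (Fin κ) => firstPart (weight lam mu) h τ)
    (m := Finset.univ.val) (u := 0)
    (Finset.nodup _) (fun s => mem_allStates) (fun τ _ => ?_) (by simp)
    (fun τ hτ τ' hτ' he => shuffle_ext h hτ hτ' he) (fun A γ hA hγ _ => exists_shuffle hA hγ) G
  rw [add_comm, firstPart_add_lastPart, tuple_perm]

theorem filterMap_id_map_some {α : Type*} (m : Multiset α) : (m.map some).filterMap id = m := by
  rw [Multiset.filterMap_map]
  exact Multiset.filterMap_some m

theorem map_some_filterMap_id {α : Type*} {m : Multiset (Option α)} (h : none ∉ m) :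
    (m.filterMap id).map some = m := by
  induction m using Multiset.induction with
  | empty => rfl
  | cons a m ih =>
    simp only [Multiset.mem_cons, not_or] at h
    cases a with
    | none => exact absurd rfl h.1
    | some a => rw [Multiset.filterMap_cons_some id (some a) m rfl, Multiset.map_cons, ih h.2]

/-- The word is the increasing list of the unmarked block labels followed by `none`. The fixed place
of the mark is no restriction, since σ ranges over representatives of all distributions of the word.
-/
theorem sum_words_marked {F : Finset (Equiv.Perm (Pos d lam mu))}
    (hF : Subgroup.IsComplement (stab lam mu : Set (Equiv.Perm (Pos d lam mu)))
      (F : Set (Equiv.Perm (Pos d lam mu))))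
    (hlam : ∀ e, 1 ≤ lam e) {R : Type*} [AddCommMonoid R] {q : ℕ} (hq : weight lam mu = q + 1)
    (h : q ≤ κ) (G : State (Option (Fin κ)) → R) :
    ∑ σ ∈ F, ∑ τ ∈ shuffles κ q,
        G ((tuple (lastPart q τ)).map some,
          blocks (extendWord (some ∘ firstPart q h τ) none ∘ posEquiv lam mu ∘ σ.symm)) =
      ∑ s ∈ markedStates κ with s.2.map Multiset.card = shape lam mu, G s := by
  refine sum_representatives hF hlam
    (A := fun τ : Equiv.Perm (Fin κ) => (tuple (lastPart q τ)).map some)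
    (w := fun τ : Equiv.Perm (Fin κ) => extendWord (some ∘ firstPart q h τ) none)
    (m := Finset.univ.val) (u := {none})
    (Finset.nodup _) (fun s => mem_markedStates) (fun τ _ => ?_) (fun τ _ => by simp)
    (fun τ hτ τ' hτ' he =>
      shuffle_ext h hτ hτ' (Multiset.map_injective (Option.some_injective _) he))
    (fun A γ hA hγ hn => ?_) G
  · have hw : tuple (extendWord (N := weight lam mu) (some ∘ firstPart q h τ) none) =
        none ::ₘ (tuple (firstPart q h τ)).map some := by
      rw [← tuple_add_tuple hq, map_tuple]
      simp [extendWord, tuple_eq_sum, Multiset.add_comm, ← Multiset.singleton_add]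
    rw [hw, univ_val_option, Multiset.add_cons, ← Multiset.map_add, add_comm,
      firstPart_add_lastPart, tuple_perm]
  · have hA' : (A.filterMap id).map some = A :=
      map_some_filterMap_id (hn none (Multiset.mem_singleton_self _))
    have hsum : A.filterMap id + γ.filterMap id = Finset.univ.val := by
      rw [← Multiset.filterMap_add, hA, univ_val_option, Multiset.filterMap_cons_none _ _ rfl,
        filterMap_id_map_some]
    have hcard : (γ.filterMap id).card = q := by
      have h1 := congrArg Multiset.card hA
      have h2 := congrArg Multiset.card hsum
      have h3 := congrArg Multiset.card hA'
      simp only [Multiset.card_add, Finset.card_val, Finset.card_univ, Fintype.card_option,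
        Fintype.card_fin, Multiset.card_map] at h1 h2 h3
      omega
    obtain ⟨τ, hτ, hτA⟩ := exists_shuffle hsum hcard
    exact ⟨τ, hτ, by rw [hτA, hA']⟩

end Words

/-! ### The right-hand side of the formula as a sum over states -/

section Formula

variable {𝕜 : Type*} [RCLike 𝕜] {n κ : ℕ} {d : ℕ} {lam mu : Fin d → ℕ}

theorem card_blocks {α : Type*} (k : Pos d lam mu → α) : (blocks k).card = ∑ e, mu e := by
  rw [← Multiset.card_map Multiset.card, map_card_blocks, card_shape]

theorem stateTerm_map_blocks {α : Type*} {f : Base 𝕜 n → 𝕜} (hf : ContDiff 𝕜 ∞ f) (c : ℕ)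
    (g : α → Fin n) {r : ℕ} (j : Fin r → α) (k : Pos d lam mu → α) (p : Jet 𝕜 n) :
    stateTerm f c (State.map g (tuple j, blocks k)) p =
      partialXY (g ∘ j) ((∑ e, mu e) - c) f p.base * jetMonomial p.2 (g ∘ k) := by
  rw [stateTerm, State.map, map_tuple, map_blocks, card_blocks, partialXY_eq hf, jetMonomial_eq]

theorem sum_termY_mul {𝒴 : Base 𝕜 n → 𝕜} (h𝒴 : ContDiff 𝕜 ∞ 𝒴) (i : Fin κ → Fin n)
    (σ : Equiv.Perm (Pos d lam mu)) (p : Jet 𝕜 n) (h : weight lam mu ≤ κ) :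
    ∑ k, termY 𝒴 i k σ p.base * jetMonomial p.2 k =
      ∑ τ ∈ shuffles κ (weight lam mu), stateTerm 𝒴 0 (State.map i
        (tuple (lastPart (weight lam mu) τ),
          blocks (firstPart (weight lam mu) h τ ∘ posEquiv lam mu ∘ σ.symm))) p := by
  simp only [termY, dif_pos h, Finset.sum_mul]
  rw [Finset.sum_comm]
  refine Finset.sum_congr rfl fun τ _ => ?_
  simp only [mul_assoc]
  rw [sum_kron_mul _ _ fun k => partialXY (lastPart (weight lam mu) (i ∘ τ)) (∑ e, mu e) 𝒴 p.base *
    jetMonomial p.2 k, stateTerm_map_blocks h𝒴]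
  rfl

/-- The free last letter x is both the superscript of 𝒳 and the index put in place of the mark
`none`. -/
theorem sum_termX_mul {𝒳 : Fin n → Base 𝕜 n → 𝕜} (h𝒳 : ∀ k, ContDiff 𝕜 ∞ (𝒳 k))
    (i : Fin κ → Fin n) (σ : Equiv.Perm (Pos d lam mu)) (p : Jet 𝕜 n)
    (h0 : 0 < weight lam mu) (h : weight lam mu - 1 ≤ κ) :
    ∑ k, termX 𝒳 i k σ p.base * jetMonomial p.2 k =
      ∑ τ ∈ shuffles κ (weight lam mu - 1), ∑ x, stateTerm (𝒳 x) 1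
        (State.map (fun o => o.elim x i)
          ((tuple (lastPart (weight lam mu - 1) τ)).map some,
            blocks (extendWord (some ∘ firstPart (weight lam mu - 1) h τ) none ∘
              posEquiv lam mu ∘ σ.symm))) p := by
  have hlt : weight lam mu - 1 < weight lam mu := by omega
  simp only [termX, dif_pos (And.intro h hlt), Finset.sum_mul]
  rw [Finset.sum_comm]
  refine Finset.sum_congr rfl fun τ _ => ?_
  rw [← (permutedEquiv σ).sum_comp]
  simp only [mul_assoc, permuted_permutedEquiv]
  rw [sum_kron_firstPart_mul (by omega) hlt.le _ fun v =>
    partialXY (lastPart (weight lam mu - 1) (i ∘ τ)) ((∑ e, mu e) - 1)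
      (𝒳 (v ⟨weight lam mu - 1, hlt⟩)) p.base * jetMonomial p.2 (permutedEquiv σ v)]
  refine Finset.sum_congr rfl fun x _ => ?_
  rw [map_tuple, stateTerm_map_blocks (h𝒳 x), permutedEquiv_apply]
  congr 2
  · simp [extendWord]
  · funext a
    simp only [Function.comp_apply, extendWord]
    split_ifs <;> rfl

theorem shape_ne_zero (hd : 1 ≤ d) (hmu : ∀ e, 1 ≤ mu e) : shape lam mu ≠ 0 := fun h => by
  have := (mem_shape (lam := lam) hmu).2 ⟨⟨0, hd⟩, rfl⟩
  simp [h] at this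

theorem sum_termY_eq {𝒴 : Base 𝕜 n → 𝕜} (h𝒴 : ContDiff 𝕜 ∞ 𝒴) (i : Fin κ → Fin n)
    (p : Jet 𝕜 n) {F : Finset (Equiv.Perm (Pos d lam mu))}
    (hF : Subgroup.IsComplement (stab lam mu : Set (Equiv.Perm (Pos d lam mu)))
      (F : Set (Equiv.Perm (Pos d lam mu))))
    (hd : 1 ≤ d) (hlam : ∀ e, 1 ≤ lam e) (hmu : ∀ e, 1 ≤ mu e) :
    ∑ σ ∈ F, ∑ k, termY 𝒴 i k σ p.base * jetMonomial p.2 k =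
      ∑ s ∈ (allStates κ).erase (Finset.univ.val, 0) with
        s.2.map Multiset.card = shape lam mu, stateTerm 𝒴 0 (s.map i) p := by
  -- The state without blocks has empty shape, so erasing it does not affect a shape with d ≥ 1.
  rw [Finset.filter_erase, Finset.erase_eq_of_notMem fun hs =>
    shape_ne_zero (lam := lam) hd hmu (Finset.mem_filter.1 hs).2.symm]
  by_cases h : weight lam mu ≤ κ
  · rw [← sum_words_all hF hlam h fun s => stateTerm 𝒴 0 (s.map i) p]
    exact Finset.sum_congr rfl fun σ _ => sum_termY_mul h𝒴 i σ p h
  -- For N > κ both sides vanish: there is no shuffle to sum over, and κ labels cannot fill N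
  -- places.
  · rw [Finset.filter_false_of_mem, Finset.sum_empty]
    · simp [termY, h]
    · intro s hs hshape
      have h1 := congrArg Multiset.card (mem_allStates.1 hs).1
      rw [Multiset.card_add, Multiset.card_join, hshape, sum_shape] at h1
      simp at h1
      omega

theorem weight_pos (hd : 1 ≤ d) (hlam : ∀ e, 1 ≤ lam e) (hmu : ∀ e, 1 ≤ mu e) :
    0 < weight lam mu :=
  lt_of_lt_of_le (Nat.mul_pos (hmu ⟨0, hd⟩) (hlam ⟨0, hd⟩))
    (Finset.single_le_sum (f := fun e => mu e * lam e) (fun _ _ => Nat.zero_le _)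
      (Finset.mem_univ _))

/-- The omitted state has one block of size κ + 1, which the condition λ_e ≤ κ excludes. -/
theorem sum_termX_eq {𝒳 : Fin n → Base 𝕜 n → 𝕜} (h𝒳 : ∀ k, ContDiff 𝕜 ∞ (𝒳 k))
    (i : Fin κ → Fin n) (p : Jet 𝕜 n) {F : Finset (Equiv.Perm (Pos d lam mu))}
    (hF : Subgroup.IsComplement (stab lam mu : Set (Equiv.Perm (Pos d lam mu)))
      (F : Set (Equiv.Perm (Pos d lam mu))))
    (hd : 1 ≤ d) (hlam : ∀ e, 1 ≤ lam e) (hlam' : ∀ e, lam e ≤ κ) (hmu : ∀ e, 1 ≤ mu e)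
    (h : weight lam mu ≤ κ + 1) :
    ∑ σ ∈ F, ∑ k, termX 𝒳 i k σ p.base * jetMonomial p.2 k =
      ∑ s ∈ (markedStates κ).erase (0, {Finset.univ.val}) with
        s.2.map Multiset.card = shape lam mu,
          ∑ x, stateTerm (𝒳 x) 1 (s.map fun o => o.elim x i) p := by
  have h0 := weight_pos hd hlam hmu
  rw [Finset.filter_erase, Finset.erase_eq_of_notMem]
  · rw [← sum_words_marked hF hlam (q := weight lam mu - 1) (by omega) (by omega)
      fun s => ∑ x, stateTerm (𝒳 x) 1 (s.map fun o => o.elim x i) p]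
    exact Finset.sum_congr rfl fun σ _ => sum_termX_mul h𝒳 i σ p h0 _
  · intro hs
    have hc : κ + 1 ∈ shape lam mu := by
      rw [← (Finset.mem_filter.1 hs).2]
      simp
    obtain ⟨e, he⟩ := (mem_shape hmu).1 hc
    have := hlam' e
    omega

/-- There are κ + 1 labels in all, so such a block contains every one of them. -/
theorem eq_of_card_block_gt {s : State (Option (Fin κ))} (hs : s ∈ markedStates κ)
    {B : Multiset (Option (Fin κ))} (hB : B ∈ s.2) (hc : κ < B.card) :
    s = (0, {Finset.univ.val}) := by
  obtain ⟨A, β⟩ := s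
  obtain ⟨β, rfl⟩ := Multiset.exists_cons_of_mem hB
  obtain ⟨h1, h0, -⟩ := mem_markedStates.1 hs
  simp only [Multiset.join_cons] at h1 h0
  have h2 := congrArg Multiset.card h1
  simp only [Multiset.card_add, Finset.card_val, Finset.card_univ, Fintype.card_option,
    Fintype.card_fin] at h2
  obtain rfl : A = 0 := Multiset.card_eq_zero.1 (by omega)
  have hj : β.join = 0 := Multiset.card_eq_zero.1 (by omega)
  have hβ := (isOn_zero_zero_iff ((0, β) : State (Option (Fin κ)))).1
    ⟨by simpa using hj, fun h => h0 (by simp [h]), by simp⟩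
  obtain rfl := (Prod.mk.inj hβ).2
  rw [← h1]
  simp

theorem explicitRHS_eq_sum_states {𝒳 : Fin n → Base 𝕜 n → 𝕜} {𝒴 : Base 𝕜 n → 𝕜}
    (h𝒳 : ∀ k, ContDiff 𝕜 ∞ (𝒳 k)) (h𝒴 : ContDiff 𝕜 ∞ 𝒴)
    {F : (d : ℕ) → (lam mu : Fin d → ℕ) → Finset (Equiv.Perm (Pos d lam mu))}
    (hF : ∀ (d : ℕ) (lam mu : Fin d → ℕ),
      Subgroup.IsComplement (stab lam mu : Set (Equiv.Perm (Pos d lam mu)))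
        (F d lam mu : Set (Equiv.Perm (Pos d lam mu))))
    (i : Fin κ → Fin n) (p : Jet 𝕜 n) :
    explicitRHS 𝒳 𝒴 F κ i p =
      ∑ s ∈ allStates κ, stateTerm 𝒴 0 (s.map i) p -
        ∑ s ∈ (markedStates κ).erase (0, {Finset.univ.val}),
          ∑ k, stateTerm (𝒳 k) 1 (s.map fun o => o.elim k i) p := by
  have hterm : ∀ d ∈ Finset.Icc 1 (κ + 1), ∀ lam ∈ lambdas κ d, ∀ mu ∈ mus κ lam,
      ∑ k : Pos d lam mu → Fin n, (∑ σ ∈ F d lam mu, termY 𝒴 i k σ p.base -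
        ∑ σ ∈ F d lam mu, termX 𝒳 i k σ p.base) * jetMonomial p.2 k =
      (∑ s ∈ (allStates κ).erase (Finset.univ.val, 0) with
        s.2.map Multiset.card = shape lam mu, stateTerm 𝒴 0 (s.map i) p) -
      ∑ s ∈ (markedStates κ).erase (0, {Finset.univ.val}) with
        s.2.map Multiset.card = shape lam mu,
          ∑ x, stateTerm (𝒳 x) 1 (s.map fun o => o.elim x i) p := by
    intro d hd lam hlam mu hmu
    have hd' := (Finset.mem_Icc.1 hd).1
    have hlam' := (mem_lambdas.1 hlam).1
    have hmu' := mem_mus.1 hmu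
    rw [← sum_termY_eq h𝒴 i p (hF d lam mu) hd' (fun e => (hlam' e).1) fun e => (hmu'.1 e).1,
      ← sum_termX_eq h𝒳 i p (hF d lam mu) hd' (fun e => (hlam' e).1) (fun e => (hlam' e).2)
        (fun e => (hmu'.1 e).1) hmu'.2, Finset.sum_comm, Finset.sum_comm (s := F d lam mu),
      ← Finset.sum_sub_distrib]
    exact Finset.sum_congr rfl fun k _ => by rw [sub_mul, Finset.sum_mul, Finset.sum_mul]
  -- The state without blocks is the leading pure x-derivative of 𝒴; all others have a shape with d
  -- ≥ 1.
  have hmem : ((Finset.univ.val, 0) : State (Fin κ)) ∈ allStates κ :=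
    mem_allStates.2 ⟨by simp, by simp, by simp⟩
  have hfirst : stateTerm 𝒴 0 (State.map i ((Finset.univ.val, 0) : State (Fin κ))) p =
      partialXY i 0 𝒴 p.base := by
    simp [stateTerm, State.map, partialXY_eq h𝒴, tuple]
  rw [explicitRHS, Finset.sum_congr rfl fun d hd => Finset.sum_congr rfl fun lam hlam =>
    Finset.sum_congr rfl fun mu hmu => hterm d hd lam hlam mu hmu]
  simp only [Finset.sum_sub_distrib]
  rw [sum_shapes, sum_shapes, ← Finset.add_sum_erase _ _ hmem, hfirst, add_sub_assoc]
  · exact fun s hs => (mem_markedStates.1 (Finset.mem_of_mem_erase hs)).2.1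
  · intro s hs h
    obtain ⟨h1, -, h2⟩ := mem_markedStates.1 (Finset.mem_of_mem_erase hs)
    rw [h, Multiset.join_zero, add_zero] at h1
    exact h2 none (Multiset.mem_singleton_self _) (h1 ▸ Finset.mem_univ (none : Option (Fin κ)))
  · intro s hs B hB
    by_contra! hc
    exact Finset.ne_of_mem_erase hs
      (eq_of_card_block_gt (Finset.mem_of_mem_erase hs) hB hc)
  · intro s hs
    have h1 := congrArg Multiset.card (mem_markedStates.1 (Finset.mem_of_mem_erase hs)).1
    simp only [Multiset.card_add, Finset.card_val, Finset.card_univ, Fintype.card_option,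
      Fintype.card_fin] at h1
    omega
  · exact fun s hs => (mem_allStates.1 (Finset.mem_of_mem_erase hs)).2.1
  · intro s hs h
    have h1 := (mem_allStates.1 (Finset.mem_of_mem_erase hs)).1
    rw [h, Multiset.join_zero, add_zero] at h1
    exact Finset.ne_of_mem_erase hs (Prod.ext h1 h)
  · intro s hs B hB
    have h1 := congrArg Multiset.card (mem_allStates.1 (Finset.mem_of_mem_erase hs)).1
    obtain ⟨β, hβ⟩ := Multiset.exists_cons_of_mem hB
    rw [hβ, Multiset.join_cons] at h1
    simp only [Multiset.card_add, Finset.card_val, Finset.card_univ, Fintype.card_fin] at h1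
    omega
  · intro s hs
    have h1 := congrArg Multiset.card (mem_allStates.1 (Finset.mem_of_mem_erase hs)).1
    simp only [Multiset.card_add, Finset.card_val, Finset.card_univ, Fintype.card_fin] at h1
    omega

end Formula

end LieProlongation

theorem theorem3p73 {𝕜 : Type*} [RCLike 𝕜] (n : ℕ)
    (𝒳 : Fin n → Base 𝕜 n → 𝕜) (𝒴 : Base 𝕜 n → 𝕜)
    (h𝒳 : ∀ k, ContDiff 𝕜 ∞ (𝒳 k)) (h𝒴 : ContDiff 𝕜 ∞ 𝒴)
    (F : (d : ℕ) → (lam mu : Fin d → ℕ) → Finset (Equiv.Perm (Pos d lam mu)))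
    (hF : ∀ (d : ℕ) (lam mu : Fin d → ℕ),
      Subgroup.IsComplement (stab lam mu : Set (Equiv.Perm (Pos d lam mu)))
        (F d lam mu : Set (Equiv.Perm (Pos d lam mu)))) :
    (∀ (κ : ℕ), 1 ≤ κ → ∀ (i : Fin κ → Fin n) (p : Jet 𝕜 n),
      prolong 𝒳 𝒴 κ i p = explicitRHS 𝒳 𝒴 F κ i p) ∧
    (∀ (d : ℕ) (lam mu : Fin d → ℕ), StrictMono lam → (∀ e, 1 ≤ lam e) → (∀ e, 1 ≤ mu e) →
      Nat.card (stab lam mu) = ∏ e, (mu e)! * ((lam e)!) ^ mu e) := by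
  exact ⟨fun κ _ i p => (prolong_eq_sum_states h𝒳 h𝒴 κ i p).trans
      (explicitRHS_eq_sum_states h𝒳 h𝒴 hF i p).symm,
    fun _ _ _ hl hlam _ => card_stab hl hlam⟩
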